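/- Throughout, $d\ge 1$ is an integer. For a bounded convex set $P\subset\mathbb R^2$, a unimodular triangulation of $P$ means a triangulation (a geometric simplicial complex) with vertices in $P\cap\mathbb Z^2$ that covers $\operatorname{conv}(P\cap\mathbb Z^2)$ and all of whose triangles have area $\tfrac12$. Let $F(\tfrac d2)$ be the number of unimodular triangulations of the half-triangle $\operatorname{conv}\{(0,0),(\tfrac d2,\tfrac d2),(d,0)\}$, and let $\widetilde F(d)$ be the number of unimodular triangulations of $\operatorname{conv}\{(0,0),(d,0),(0,d)\}$ that are invariant under the reflection in the line $x=y$. Put \[ U(d)=\begin{cases}2^{\frac34d^2-d}, & d\text{ even},\\ 2^{\frac34d^2+d-\frac74}, & d\text{ odd}.\end{cases} \] Then for every $d\ge1$ \[ F\left(\tfrac d2\right)\ \le\ U(d)\ \le\ 2^{\frac34d^2+d-\frac34} \qquad\text{and}\qquad \widetilde F(d)\ \le\ 2^{\lfloor d/2\rfloor}\cdot U(d). \] Moreover there are constants $c,C>0$ and $d_0$ such that for all $d\ge d_0$ \[ 2^{c\,d^2}\ \le\ \widetilde F(d) \qquad\text{and}\qquad 2^{\lfloor d/2\rfloor}\cdot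 U(d)\ \le\ 2^{C\,d^2}, \] that is, $2^{\Omega(d^2)}\le\widetilde F(d)\le 2^{\lfloor d/2\rfloor}\cdot U(d)\le 2^{O(d^2)}$. -/

import Mathlib

open Geometry

noncomputable section

namespace SymTri

/-- The lattice points (points of `ℤ²`) of a subset `P` of the plane. -/
def latticePoints (P : Set (ℝ × ℝ)) : Set (ℝ × ℝ) :=
  {p | p ∈ P ∧ ∃ a b : ℤ, p = ((a : ℝ), (b : ℝ))}

/-- Twice the signed area of the triangle with vertices `a`, `b`, `c`. -/
def det3 (a b c : ℝ × ℝ) : ℝ :=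
  (b.1 - a.1) * (c.2 - a.2) - (c.1 - a.1) * (b.2 - a.2)

/-- `K` is a unimodular triangulation of the point configuration formed by the lattice points
of `P`: a geometric simplicial complex whose vertices are lattice points of `P`, which covers
exactly the convex hull of the lattice points of `P`, and all of whose triangles are unimodular,
that is, have area `1/2`.
(A complex in the plane covering a two-dimensional convex polygon has only triangles as
maximal faces.) -/
structure IsUnimodularTriangulation (P : Set (ℝ × ℝ)) (K : SimplicialComplex ℝ (ℝ × ℝ)) :
    Prop where
  vertices_subset : K.vertices ⊆ latticePoints P
  space_eq : K.space = convexHull ℝ (latticePoints P)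
  unimodular : ∀ s ∈ K.faces, ∀ a ∈ s, ∀ b ∈ s, ∀ c ∈ s,
    a ≠ b → a ≠ c → b ≠ c → |det3 a b c| = 1

/-- `K` is invariant under the reflection `(x, y) ↦ (y, x)` in the line `x = y`.
(The reflection is an involution, so one inclusion gives equality.) -/
def IsSymmetric (K : SimplicialComplex ℝ (ℝ × ℝ)) : Prop :=
  ∀ s ∈ K.faces, s.map (Equiv.prodComm ℝ ℝ).toEmbedding ∈ K.faces

/-- The dilated standard triangle `conv {(0,0), (d,0), (0,d)}`. -/
def dilatedTriangle (d : ℕ) : Set (ℝ × ℝ) :=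
  convexHull ℝ {((0 : ℝ), (0 : ℝ)), ((d : ℝ), (0 : ℝ)), ((0 : ℝ), (d : ℝ))}

/-- The half-triangle `conv {(0,0), (d/2,d/2), (d,0)}`. -/
def halfTriangle (d : ℕ) : Set (ℝ × ℝ) :=
  convexHull ℝ {((0 : ℝ), (0 : ℝ)), ((d : ℝ) / 2, (d : ℝ) / 2), ((d : ℝ), (0 : ℝ))}

/-- The number of unimodular triangulations of the half-triangle. -/
def halfCount (d : ℕ) : ℕ :=
  Set.ncard {K | IsUnimodularTriangulation (halfTriangle d) K}

/-- The number of unimodular triangulations of the dilated standard triangle that are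
symmetric under the reflection in the line `x = y`. -/
def symCount (d : ℕ) : ℕ :=
  Set.ncard {K | IsUnimodularTriangulation (dilatedTriangle d) K ∧ IsSymmetric K}

/-- The explicit upper bound for the number of unimodular triangulations of the half-triangle. -/
def U (d : ℕ) : ℝ :=
  if Even d then (2 : ℝ) ^ (3 / 4 * (d : ℝ) ^ 2 - (d : ℝ))
  else (2 : ℝ) ^ (3 / 4 * (d : ℝ) ^ 2 + (d : ℝ) - 7 / 4)

/-! The sets counted above are finite, so `Set.ncard` is their genuine cardinality. -/

theorem finite_latticePoints {P : Set (ℝ × ℝ)} (hP : Bornology.IsBounded P) :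
    (latticePoints P).Finite := by
  obtain ⟨r, hr⟩ := hP.subset_closedBall 0
  obtain ⟨N, hN⟩ := exists_nat_ge r
  refine (((Set.finite_Icc (-(N : ℤ)) N).prod (Set.finite_Icc (-(N : ℤ)) N)).image
    (fun z : ℤ × ℤ => ((z.1 : ℝ), (z.2 : ℝ)))).subset ?_
  rintro p ⟨hp, a, b, rfl⟩
  have h := hr hp
  rw [mem_closedBall_zero_iff, Prod.norm_def, max_le_iff, Real.norm_eq_abs, Real.norm_eq_abs,
    abs_le, abs_le] at h
  refine ⟨(a, b), ⟨⟨?_, ?_⟩, ⟨?_, ?_⟩⟩, rfl⟩ <;>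
    (simp only; rify; linarith [h.1.1, h.1.2, h.2.1, h.2.2])

theorem finite_triangulations {P : Set (ℝ × ℝ)} (hP : Bornology.IsBounded P) :
    {K | IsUnimodularTriangulation P K}.Finite := by
  have hfin := finite_latticePoints hP
  have h1 : {s : Finset (ℝ × ℝ) | (s : Set (ℝ × ℝ)) ⊆ latticePoints P}.Finite :=
    hfin.finite_subsets.preimage (Finset.coe_injective.injOn)
  refine Set.Finite.of_finite_image (f := fun K : SimplicialComplex ℝ (ℝ × ℝ) => K.faces)
    (h1.finite_subsets.subset ?_) (fun K _ L _ h => SimplicialComplex.ext h)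
  rintro _ ⟨K, hK, rfl⟩ s hs x hx
  exact hK.vertices_subset
    (K.down_closed hs (Finset.singleton_subset_iff.2 hx) (Finset.singleton_nonempty x))

theorem finite_halfTriangle (d : ℕ) :
    {K | IsUnimodularTriangulation (halfTriangle d) K}.Finite :=
  finite_triangulations (isBounded_convexHull.2 (Set.toFinite _).isBounded)

theorem finite_dilatedTriangle (d : ℕ) :
    {K | IsUnimodularTriangulation (dilatedTriangle d) K ∧ IsSymmetric K}.Finite :=
  (finite_triangulations (isBounded_convexHull.2 (Set.toFinite _).isBounded)).subset
    fun _ h => h.1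

end SymTri

end

/-! Upper bounds. When the lattice points are not collinear, a unimodular triangulation is
determined by its edges, and every half-integral, non-lattice point of the polygon is the midpoint
of exactly one edge (`exists_add_eq`, `eq_or_eq_of_add_eq`). Order these midpoints by a linear
functional that separates them and reveal the edges one at a time. If two triangulations agree at
all earlier midpoints, then at the next one they have the same edge or the two diagonals of a
parallelogram of area 1 (`cross`). A parity argument shows that three segments cannot pairwise be
such diagonals (`not_three_diagonals`), so each midpoint offers at most two choices. If the edges at
a set `M` of midpoints decide the others, in a way compatible with the order, there are at most `2 ^
|M|` triangulations (`ncard_le_two_pow`).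

Boundary edges are forced, so for the half-triangle `M` consists of the interior midpoints. For
symmetric triangulations of the full triangle, `M` consists of the midpoints below the axis and on
it: with the order by `x + y`, then `y`, an edge with midpoint above the axis is the mirror image of
one met earlier. Counting `M` gives `U d` and the extra factor `2 ^ (d / 2)`.

Lower bound. Cut the triangle into unit squares, choose the diagonals freely in a `k × k` block on
one side of the axis, `k = d / 3`, and reflect (`two_pow_sq_le_symCount`). That such a choice gives
a simplicial complex follows from its hat functions: they recover the barycentric coordinates of a
point from the point alone, whichever face contains it (`hat_eq_of_mem`). -/

namespace SymTri

/-! ### Lattice frames and the combinatorial properties of a triangulation. -/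

/-- Twice the signed area of a lattice triangle. -/
def idet (a b c : ℤ × ℤ) : ℤ :=
  (b.1 - a.1) * (c.2 - a.2) - (c.1 - a.1) * (b.2 - a.2)

theorem idet_swap (a b c : ℤ × ℤ) : idet b a c = -idet a b c := by
  unfold idet; ring

/-- The lattice point with coordinates `(s, t)` in the affine frame at `p` spanned by
`a - p` and `h - p`. -/
def frame (p a h : ℤ × ℤ) (s t : ℤ) : ℤ × ℤ := p + s • (a - p) + t • (h - p)

theorem idet_frame (p a h : ℤ × ℤ) (s₁ t₁ s₂ t₂ s₃ t₃ : ℤ) :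
    idet (frame p a h s₁ t₁) (frame p a h s₂ t₂) (frame p a h s₃ t₃) =
      idet p a h * ((s₂ - s₁) * (t₃ - t₁) - (s₃ - s₁) * (t₂ - t₁)) := by
  simp only [idet, frame, Prod.fst_add, Prod.snd_add, Prod.smul_fst, Prod.smul_snd, Prod.fst_sub,
    Prod.snd_sub, smul_eq_mul]
  ring

theorem frame_zero_zero (p a h : ℤ × ℤ) : frame p a h 0 0 = p := by simp [frame]
theorem frame_one_zero (p a h : ℤ × ℤ) : frame p a h 1 0 = a := by simp [frame]
theorem frame_zero_one (p a h : ℤ × ℤ) : frame p a h 0 1 = h := by simp [frame]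

/-- Cramer's rule: the determinant `ε` is its own inverse, so a unimodular triangle gives integral
coordinates to every lattice point. -/
theorem eq_frame {p a h : ℤ × ℤ} {ε : ℤ} (hε : ε * ε = 1) (hd : idet p a h = ε) (q : ℤ × ℤ) :
    q = frame p a h (ε * idet p q h) (ε * idet p a q) := by
  obtain ⟨p1, p2⟩ := p; obtain ⟨a1, a2⟩ := a; obtain ⟨h1, h2⟩ := h; obtain ⟨q1, q2⟩ := q
  subst hd
  simp only [idet, frame] at hε ⊢
  ext <;> simp only [Prod.fst_add, Prod.snd_add, Prod.smul_fst, Prod.smul_snd, Prod.fst_sub,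
    Prod.snd_sub, smul_eq_mul]
  · linear_combination (p1 - q1) * hε
  · linear_combination (p2 - q2) * hε

theorem map_frame (f : ℤ × ℤ →ₗ[ℤ] ℤ) (p a h : ℤ × ℤ) (s t : ℤ) :
    f (frame p a h s t) = f p + s * (f a - f p) + t * (f h - f p) := by
  simp only [frame, map_add, map_smul, map_sub, smul_eq_mul]

/-- The combinatorial properties of the edges `E` and the triangles `T` of a unimodular
triangulation whose vertices are the lattice points `V` of a polygon. -/
structure IsLatticeTriangulation (V : Set (ℤ × ℤ)) (E : ℤ × ℤ → ℤ × ℤ → Prop)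
    (T : ℤ × ℤ → ℤ × ℤ → ℤ × ℤ → Prop) : Prop where
  mem : ∀ {a b}, E a b → a ∈ V
  symm : ∀ {a b}, E a b → E b a
  rotate : ∀ {a b c}, T a b c → T b c a
  swap : ∀ {a b c}, T a b c → T b a c
  edge : ∀ {a b c}, T a b c → E a b
  unimodular : ∀ {a b c}, T a b c → idet a b c = 1 ∨ idet a b c = -1
  coprime : ∀ {a b}, E a b → IsCoprime (b.1 - a.1) (b.2 - a.2)
  not_cross : ∀ {a b c d}, E a b → E c d → idet a b c * idet a b d < 0 →
    idet c d a * idet c d b < 0 → False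
  extend : ∀ {a b c}, E a b → c ∈ V → 0 < idet a b c → ∃ c', T a b c' ∧ idet a b c' = 1
  direction : ∀ {p q}, p ∈ V → q ∈ V → IsCoprime (q.1 - p.1) (q.2 - p.2) →
    E p q ∨ ∃ a h, T p a h ∧ idet p a h = 1 ∧ 0 < idet p a q ∧ 0 < idet p q h

/-- `q₁` is the reflection of `p₁` in the common midpoint. Hence two non-collinear segments with the
same midpoint satisfy the sign conditions of `not_cross`. -/
theorem idet_of_add_eq {p q p₁ q₁ : ℤ × ℤ} (hs : p₁ + q₁ = p + q) :
    idet p₁ q₁ p = -idet p q p₁ ∧ idet p₁ q₁ q = idet p q p₁ ∧ idet p q q₁ = -idet p q p₁ := by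
  have : q₁ = p + q - p₁ := by rw [← hs]; abel
  subst this
  simp only [idet, Prod.fst_add, Prod.snd_add, Prod.fst_sub, Prod.snd_sub]
  refine ⟨?_, ?_, ?_⟩ <;> ring

/-! ### Two triangulations that agree on all earlier edges. -/

namespace IsLatticeTriangulation

variable {V : Set (ℤ × ℤ)} {E E₁ E₂ : ℤ × ℤ → ℤ × ℤ → Prop}
  {T T₁ T₂ : ℤ × ℤ → ℤ × ℤ → ℤ × ℤ → Prop}

/-- The sign `ε` records the side of the edge, so that mirror-image configurations share one
argument. -/
theorem extend_sign (hT : IsLatticeTriangulation V E T) {a b c : ℤ × ℤ} {ε : ℤ}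
    (hε : ε = 1 ∨ ε = -1) (hab : E a b) (hc : c ∈ V) (h : 0 < ε * idet a b c) :
    ∃ c', T a b c' ∧ idet a b c' = ε := by
  rcases hε with rfl | rfl
  · exact hT.extend hab hc (by simpa using h)
  · obtain ⟨c', h1, h2⟩ := hT.extend (hT.symm hab) hc (by rw [idet_swap]; linarith)
    exact ⟨c', hT.swap h1, by rw [idet_swap] at h2; linarith⟩

/-- No edge enters the interior of a triangle from one of its vertices. -/
theorem not_edge_of_cone (hT : IsLatticeTriangulation V E T) {p a h c : ℤ × ℤ} {ε : ℤ}
    (hε : ε = 1 ∨ ε = -1) (ht : T p a h) (hd : idet p a h = ε) {s t : ℤ}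
    (hs : 0 < s) (ht' : 0 < t) (hc : c = frame p a h s t) : ¬E p c := by
  -- The segment from `p` to `c` meets the opposite side `a h`: `s` and `t` are positive integers,
  -- so `s + t ≥ 2` and `c` lies beyond that side.
  intro hpc
  refine hT.not_cross hpc (hT.edge (hT.rotate ht)) ?_ ?_
  · have h1 := idet_frame p a h 0 0 s t 1 0
    have h2 := idet_frame p a h 0 0 s t 0 1
    rw [← hc, frame_zero_zero, frame_one_zero] at h1
    rw [← hc, frame_zero_zero, frame_zero_one] at h2
    rw [h1, h2, hd]
    rcases hε with rfl | rfl <;> nlinarith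
  · have h1 := idet_frame p a h 1 0 0 1 0 0
    have h2 := idet_frame p a h 1 0 0 1 s t
    rw [frame_zero_zero, frame_one_zero, frame_zero_one] at h1
    rw [← hc, frame_one_zero, frame_zero_one] at h2
    rw [h1, h2, hd]
    rcases hε with rfl | rfl <;> nlinarith

/-- Collinear edges with the same midpoint coincide. -/
theorem eq_of_collinear {a b c d : ℤ × ℤ} (h₁ : IsCoprime (b.1 - a.1) (b.2 - a.2))
    (h₂ : IsCoprime (d.1 - c.1) (d.2 - c.2)) (hs : a + b = c + d) (h0 : idet a b c = 0) :
    (a = c ∧ b = d) ∨ (a = d ∧ b = c) := by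
  obtain ⟨a1, a2⟩ := a; obtain ⟨b1, b2⟩ := b; obtain ⟨c1, c2⟩ := c; obtain ⟨d1, d2⟩ := d
  simp only [Prod.mk_add_mk, Prod.mk.injEq, idet] at *
  obtain ⟨hs1, hs2⟩ := hs
  obtain ⟨u, v, huv⟩ := h₁
  obtain ⟨u', v', huv'⟩ := h₂
  have hdet : (b1 - a1) * (d2 - c2) = (b2 - a2) * (d1 - c1) := by
    have e1 : d2 = a2 + b2 - c2 := by linarith
    have e2 : d1 = a1 + b1 - c1 := by linarith
    subst e1 e2
    linear_combination (-2) * h0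
  -- the factor between the two primitive vectors
  set k := u * (d1 - c1) + v * (d2 - c2) with hk
  have hk1 : d1 - c1 = k * (b1 - a1) := by
    linear_combination (-(d1 - c1)) * huv - v * hdet
  have hk2 : d2 - c2 = k * (b2 - a2) := by
    linear_combination (-(d2 - c2)) * huv + u * hdet
  have hunit : k * (u' * (b1 - a1) + v' * (b2 - a2)) = 1 := by
    rw [hk1, hk2] at huv'; linarith
  rcases Int.eq_one_or_neg_one_of_mul_eq_one hunit with h | h <;> rw [h] at hk1 hk2
  · left; omega
  · right; omega

/-- An edge through the midpoint of the third side of an empty unimodular triangle has one end at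
height one. -/
theorem idet_of_edges (hT : IsLatticeTriangulation V E T) {p a c p₁ q₁ : ℤ × ℤ} {ε : ℤ}
    (hε : ε = 1 ∨ ε = -1) (hcd : idet p a c = ε) (Eap : E a p) (Eaq : E a c) (e₁ : E p₁ q₁)
    (hs : p₁ + q₁ = p + c) (hpos : 0 < ε * idet p p₁ c) : idet p p₁ c = ε := by
  have hε2 : ε * ε = 1 := by rcases hε with rfl | rfl <;> rfl
  have hp₁ := eq_frame hε2 hcd p₁
  have hsd : idet p p₁ c = ε * (ε * idet p p₁ c) := by rw [← mul_assoc, hε2, one_mul]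
  set s := ε * idet p p₁ c
  set t := ε * idet p a p₁ with htd
  clear_value s t
  have hq₁ : q₁ = frame p a c (-s) (1 - t) := by
    have : q₁ = p + c - p₁ := by rw [← hs]; abel
    rw [this, hp₁]
    ext <;> simp [frame] <;> ring
  have hs1 : s = 1 := by
    by_contra hs1
    have hs2 : 2 ≤ s := by omega
    have i1 := idet_frame p a c s t (-s) (1 - t) 1 0
    have i2 := idet_frame p a c s t (-s) (1 - t) 0 0
    have i3 := idet_frame p a c s t (-s) (1 - t) 0 1
    have j1 := idet_frame p a c 1 0 0 0 s t
    have j2 := idet_frame p a c 1 0 0 0 (-s) (1 - t)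
    have k1 := idet_frame p a c 1 0 0 1 s t
    have k2 := idet_frame p a c 1 0 0 1 (-s) (1 - t)
    simp only [frame_zero_zero, frame_one_zero, frame_zero_one, ← hp₁, ← hq₁, hcd]
      at i1 i2 i3 j1 j2 k1 k2
    -- In the frame at `p` the segment joins `(s, t)` to `(-s, 1 - t)`, and `a` is `(1, 0)`. The
    -- sign of `s + 2t - 1` tells on which side of it `a` lies: it crosses `a p`, or passes through
    -- `a`, or crosses `a c`. In the middle case its vector is `s (-2, 1)`, not primitive when `s ≥
    -- 2`.
    rcases lt_trichotomy s (1 - 2 * t) with hlt | heq | hgt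
    · refine hT.not_cross e₁ Eap ?_ ?_
      · rw [i1, i2]
        have : (s + 2 * t - 1) * s < 0 := mul_neg_of_neg_of_pos (by omega) (by omega)
        linear_combination this + (s + 2 * t - 1) * s * hε2
      · rw [j1, j2]
        have : t * (1 - t) < 0 := mul_neg_of_neg_of_pos (by omega) (by omega)
        linear_combination this + t * (1 - t) * hε2
    · have hcop := hT.coprime e₁
      have d1 : q₁.1 - p₁.1 = s * (c.1 - p.1 - 2 * (a.1 - p.1)) := by
        rw [hq₁, hp₁]
        simp [frame]
        linear_combination (-(c.1 - p.1)) * heq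
      have d2 : q₁.2 - p₁.2 = s * (c.2 - p.2 - 2 * (a.2 - p.2)) := by
        rw [hq₁, hp₁]
        simp [frame]
        linear_combination (-(c.2 - p.2)) * heq
      rw [d1, d2] at hcop
      have hu : IsUnit s := hcop.isUnit_of_dvd' (dvd_mul_right _ _) (dvd_mul_right _ _)
      rcases Int.isUnit_iff.1 hu with h | h <;> omega
    · refine hT.not_cross e₁ Eaq ?_ ?_
      · rw [i1, i3]
        have : 0 < (s + 2 * t - 1) * s := mul_pos (by omega) (by omega)
        linear_combination this - (s + 2 * t - 1) * s * hε2
      · rw [k1, k2]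
        have : 0 < (s + t - 1) * (s + t) := mul_pos (by omega) (by omega)
        linear_combination this - (s + t - 1) * (s + t) * hε2
  rw [hsd, hs1, mul_one]

/-- The main case of `cross`: the triangle `p a h` of the first triangulation that meets the edge
`p q` of the second one near `p` has its vertex `a` below `p`. -/
theorem cross_aux (h₁ : IsLatticeTriangulation V E₁ T₁) (h₂ : IsLatticeTriangulation V E₂ T₂)
    (f : ℤ × ℤ →ₗ[ℤ] ℤ) {p q p₁ q₁ a h : ℤ × ℤ} (e₂ : E₂ p q) (e₁ : E₁ p₁ q₁)
    (hs : p₁ + q₁ = p + q)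
    (agree : ∀ a b, f (a + b) < f (p + q) → (E₁ a b ↔ E₂ a b))
    (hne : idet p q p₁ ≠ 0) {ε : ℤ} (hε : ε = 1 ∨ ε = -1) (hT : T₁ p a h) (hd : idet p a h = ε)
    (hα : 0 < ε * idet p q h) (hβ : 0 < ε * idet p a q) (hx : f a < f p) (hpq : f p < f q)
    (hgt : f p + f q < f a + f h) :
    idet p q p₁ = 1 ∨ idet p q p₁ = -1 := by
  have hε2 : ε * ε = 1 := by rcases hε with rfl | rfl <;> rfl
  have hq := eq_frame hε2 hd q
  have hdq := hβ
  set α := ε * idet p q h with hαd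
  set β := ε * idet p a q with hβd
  have fq : f q = f p + α * (f a - f p) + β * (f h - f p) := by
    rw [← map_frame, ← hq]
  have Eap₁ : E₁ a p := h₁.symm (h₁.edge hT)
  -- As `f a < f p < f q`, the midpoint of `a p` precedes that of `p q`, so this edge is shared. The
  -- plan is to show that the triangle of the second triangulation on it, towards `q`, has apex `q`
  -- itself.
  have Eap₂ : E₂ a p := (agree a p (by simp only [map_add]; linarith)).1 Eap₁
  obtain ⟨c, hc, hcd⟩ := h₂.extend_sign (ε := ε) hε (h₂.symm Eap₂) (h₂.mem (h₂.symm e₂)) hdq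
  have hcf := eq_frame hε2 hd c
  rw [hcd, hε2] at hcf
  set γ := ε * idet p c h with hγd
  have fc : f c = f p + γ * (f a - f p) + 1 * (f h - f p) := by rw [← map_frame, ← hcf]
  -- `q` is not strictly inside the cone of the triangle `p, a, c`
  have hαγ : α ≤ β * γ := by
    by_contra hlt
    push Not at hlt
    refine h₂.not_edge_of_cone hε hc hcd (s := α - β * γ) (t := β) (by linarith) hβ ?_ e₂
    rw [hq, hcf]
    ext <;> simp [frame] <;> ring
  have hγ : 0 < γ := by
    by_contra hle
    push Not at hle
    nlinarith
  -- `p c` enters the triangle `p a h` of the first triangulation and so is not an edge of it. Being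
  -- an edge of the second one, it cannot precede `p q`.
  have hncE : ¬E₁ p c := h₁.not_edge_of_cone hε hT hd hγ one_pos hcf
  have hfc : f q ≤ f c := by
    by_contra hlt
    push Not at hlt
    exact hncE ((agree p c (by simp only [map_add]; linarith)).2
      (h₂.edge (h₂.swap (h₂.rotate (h₂.rotate hc)))))
  -- Since `f a < f p` and `α ≤ β γ`, one gets `β (f c - f p) ≤ f q - f p ≤ f c - f p` with `f q - f
  -- p > 0`. With `β = 1` the same inequalities force `γ = α`, that is `c = q`.
  have hβ1 : β = 1 := by
    by_contra hb
    have hb2 : 2 ≤ β := by omega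
    have h1 : β * f c = β * f p + β * γ * (f a - f p) + β * (f h - f p) := by rw [fc]; ring
    nlinarith
  have hγα : γ = α := by
    rw [hβ1] at hαγ fq
    nlinarith
  have hcq : c = q := by rw [hcf, hq, hβ1, hγα]
  subst hcq
  have Eaq : E₁ a c := (agree a c (by simp only [map_add]; linarith)).2 
    (h₂.edge (h₂.rotate hc))
  have hneg : idet p q₁ c = -idet p p₁ c := by
    have : q₁ = p + c - p₁ := by rw [← hs]; abel
    rw [this]; simp only [idet, Prod.fst_add, Prod.snd_add, Prod.fst_sub, Prod.snd_sub]; ring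
  have hflip : idet p c p₁ = -idet p p₁ c := by unfold idet; ring
  have hne' : ε * idet p p₁ c ≠ 0 := by
    rcases hε with rfl | rfl <;> simpa [hflip] using hne
  -- Exactly one of `p₁`, `q₁` is on the same side of `p c` as `a`; `idet_of_edges` applies to that
  -- end.
  rcases lt_or_gt_of_ne hne' with hlt | hgt
  · have := h₁.idet_of_edges hε hcd Eap₁ Eaq (h₁.symm e₁) (by rw [add_comm, hs])
      (by rw [hneg]; linarith)
    rcases hε with rfl | rfl <;> omega
  · have := h₁.idet_of_edges hε hcd Eap₁ Eaq e₁ hs hgt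
    rcases hε with rfl | rfl <;> omega

/-- If two triangulations agree on all edges that precede the midpoint of `p q`, then their edges
at this midpoint are equal or diagonals of a unimodular parallelogram. -/
theorem cross (h₁ : IsLatticeTriangulation V E₁ T₁) (h₂ : IsLatticeTriangulation V E₂ T₂)
    (f : ℤ × ℤ →ₗ[ℤ] ℤ)
    (hf : ∀ a ∈ V, ∀ b ∈ V, ∀ c ∈ V, ∀ d ∈ V, f (a + b) = f (c + d) → a + b = c + d)
    {p q p₁ q₁ : ℤ × ℤ} (e₂ : E₂ p q) (e₁ : E₁ p₁ q₁) (hs : p₁ + q₁ = p + q)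
    (agree : ∀ a b, f (a + b) < f (p + q) → (E₁ a b ↔ E₂ a b)) (hne : idet p q p₁ ≠ 0) :
    idet p q p₁ = 1 ∨ idet p q p₁ = -1 := by
  wlog hpq : f p < f q generalizing p q
  · rcases lt_or_eq_of_le (not_lt.1 hpq) with hlt | heq
    · have := this (h₂.symm e₂) (by rw [hs, add_comm]) (by rwa [add_comm q p])
        (by rw [idet_swap]; simpa using hne) hlt
      rw [idet_swap] at this
      omega
    · have hp := h₂.mem e₂
      have hq := h₂.mem (h₂.symm e₂)
      have h := hf p hp p hp q hq q hq (by simp [heq])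
      have : p = q := by
        ext
        · have := congrArg Prod.fst h; simp at this; omega
        · have := congrArg Prod.snd h; simp at this; omega
      exact absurd (by rw [this]; simp [idet]) hne
  have hsplit : idet p₁ q₁ p * idet p₁ q₁ q < 0 ∧ idet p q p₁ * idet p q q₁ < 0 := by
    obtain ⟨h1, h2, h3⟩ := idet_of_add_eq hs
    rw [h1, h2, h3]
    have := mul_self_pos.2 hne
    constructor <;> linarith
  -- Leave `p` towards `q` inside the first triangulation. Running along an edge is impossible, as
  -- `p q` would cross `p₁ q₁`; so one enters a triangle `p a h`.
  obtain h | ⟨a, h, hT, hd, hβ, hα⟩ := h₁.direction (h₂.mem e₂)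
    (h₂.mem (h₂.symm e₂)) (h₂.coprime e₂)
  · exact (h₁.not_cross e₁ h hsplit.1 hsplit.2).elim
  have hq := eq_frame (ε := 1) rfl hd q
  set α := idet p q h with hαd
  set β := idet p a q with hβd
  simp only [one_mul] at hq
  have fq : f q = f p + α * (f a - f p) + β * (f h - f p) := by
    rw [← map_frame, ← hq]
  have Eah : E₁ a h := h₁.edge (h₁.rotate hT)
  -- Here `p a q h` is a unimodular parallelogram and `a h` has the midpoint of `p₁ q₁`, so both are
  -- the same edge.
  by_cases hαβ : α = 1 ∧ β = 1
  · have hsum : a + h = p₁ + q₁ := by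
      rw [hs, hq, hαβ.1, hαβ.2]; simp [frame]; abel
    by_cases h0 : idet a h p₁ = 0
    · rcases eq_of_collinear (h₁.coprime Eah) (h₁.coprime e₁) hsum h0 with ⟨rfl, -⟩ | ⟨-, rfl⟩
      · have : idet p q a = -β := by rw [hβd]; unfold idet; ring
        omega
      · omega
    · obtain ⟨h1, h2, h3⟩ := idet_of_add_eq hsum.symm
      refine (h₁.not_cross Eah e₁ ?_ ?_).elim
      · rw [h3]
        linarith [mul_self_pos.2 h0]
      · rw [h1, h2]
        linarith [mul_self_pos.2 h0]
  have hαβ2 : 2 < α + β := by omega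
  have hnot : ¬E₂ a h := by
    intro hE
    refine h₂.not_cross e₂ hE ?_ ?_
    · rw [show idet p q a = -β by rw [hβd]; unfold idet; ring, ← hαd]
      nlinarith
    · have h1 := idet_frame p a h 1 0 0 1 0 0
      have h2 := idet_frame p a h 1 0 0 1 α β
      rw [frame_zero_zero, frame_one_zero, frame_zero_one] at h1
      rw [← hq, frame_one_zero, frame_zero_one] at h2
      rw [h1, h2, hd]
      linarith
  -- `a h` crosses `p q` and is therefore missing from the second triangulation, so it cannot come
  -- earlier in the order.
  have hge : f p + f q ≤ f a + f h := by
    by_contra hlt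
    exact hnot ((agree a h (by simp only [map_add]; linarith)).1 Eah)
  have hgt : f p + f q < f a + f h := by
    refine lt_of_le_of_ne hge fun heq => ?_
    have h1 := hf p (h₂.mem e₂) q (h₂.mem (h₂.symm e₂)) a (h₁.mem Eah) h (h₁.mem (h₁.symm Eah))
      (by simp only [map_add, heq])
    have h2 : q = frame p a h 1 1 := by
      rw [show q = a + h - p by rw [← h1]; abel]; simp [frame]; abel
    have e1 := idet_frame p a h 0 0 1 0 1 1
    have e2 := idet_frame p a h 0 0 1 1 0 1
    rw [frame_zero_zero, frame_one_zero, ← h2, hd] at e1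
    rw [frame_zero_zero, frame_zero_one, ← h2, hd] at e2
    exact hαβ ⟨by rw [hαd, e2]; norm_num, by rw [hβd, e1]; norm_num⟩
  -- One of `a`, `h` is below `p`: otherwise `α, β ≥ 1` would give `f q - f p ≥ (f a - f p) + (f h -
  -- f p)`, against `hgt`. The case of `h` is the mirror image, with `ε = -1`.
  rcases lt_or_ge (f a) (f p) with hx | hx
  · exact cross_aux h₁ h₂ f e₂ e₁ hs agree hne (Or.inl rfl) hT hd (by simpa using hα)
      (by simpa using hβ) hx hpq hgt
  rcases lt_or_ge (f h) (f p) with hy | hy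
  · refine cross_aux h₁ h₂ f e₂ e₁ hs agree hne (Or.inr rfl) (h₁.rotate (h₁.swap hT)) ?_ ?_ ?_
      hy hpq (by linarith)
    · rw [← hd]; unfold idet; ring
    · rw [show idet p q a = -β by rw [hβd]; unfold idet; ring]; linarith
    · rw [show idet p h q = -α by rw [hαd]; unfold idet; ring]; linarith
  · nlinarith

/-- The edges of a triangulation determine its triangles. -/
theorem triangle_of_edges (h₁ : IsLatticeTriangulation V E₁ T₁)
    (h₂ : IsLatticeTriangulation V E₂ T₂) (hE : ∀ a b, E₁ a b ↔ E₂ a b) {a b c : ℤ × ℤ}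
    (ht : T₁ a b c) : T₂ a b c := by
  have hε := h₁.unimodular ht
  obtain ⟨ε, hd⟩ : ∃ ε, idet a b c = ε := ⟨_, rfl⟩
  rw [hd] at hε
  have hε2 : ε * ε = 1 := by rcases hε with rfl | rfl <;> rfl
  have hbc := h₁.edge (h₁.rotate ht)
  have hca := h₁.edge (h₁.rotate (h₁.rotate ht))
  obtain ⟨c', ht', hd'⟩ := h₂.extend_sign hε ((hE _ _).1 (h₁.edge ht)) (h₁.mem hca)
    (by rw [hd, hε2]; exact one_pos)
  have hc' := eq_frame hε2 hd c'
  rw [hd', hε2] at hc'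
  generalize ε * idet a c' c = s at hc'
  -- Both apexes have height one over `a b`, so `c' = c + s (b - a)`. If `s ≠ 0`, one of the sides
  -- `a c`, `a c'` enters the triangle of the other triangulation.
  rcases lt_trichotomy s 0 with h | rfl | h
  · refine (h₂.not_edge_of_cone hε ht' hd' (s := -s) (t := 1) (by linarith) one_pos ?_
      ((hE _ _).1 (h₁.symm hca))).elim
    rw [hc']
    ext <;> simp [frame] <;> ring
  · rw [frame_zero_one] at hc'
    rwa [← hc']
  · exact (h₁.not_edge_of_cone hε ht hd h one_pos hc'
      ((hE _ _).2 (h₂.symm (h₂.edge (h₂.rotate (h₂.rotate ht')))))).elim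

end IsLatticeTriangulation

/-- Three segments with a common midpoint are not pairwise diagonals of unimodular
parallelograms. -/
theorem not_three_diagonals {p₁ q₁ p₂ q₂ p₃ : ℤ × ℤ} (h₂ : p₂ + q₂ = p₁ + q₁)
    (h₁₂ : idet p₁ q₁ p₂ = 1 ∨ idet p₁ q₁ p₂ = -1)
    (h₁₃ : idet p₁ q₁ p₃ = 1 ∨ idet p₁ q₁ p₃ = -1)
    (h₂₃ : idet p₂ q₂ p₃ = 1 ∨ idet p₂ q₂ p₃ = -1) : False := by
  have : q₂ = p₁ + q₁ - p₂ := by rw [← h₂]; abel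
  -- Modulo 2 this reads odd = odd - odd, the contradiction wanted.
  have key : idet p₂ q₂ p₃ = idet p₁ q₁ p₃ - idet p₁ q₁ p₂ -
      2 * ((p₂.1 - p₁.1) * (p₃.2 - p₁.2) - (p₃.1 - p₁.1) * (p₂.2 - p₁.2)) := by
    rw [this]; simp only [idet, Prod.fst_add, Prod.snd_add, Prod.fst_sub, Prod.snd_sub]; ring
  generalize (p₂.1 - p₁.1) * (p₃.2 - p₁.2) - (p₃.1 - p₁.1) * (p₂.2 - p₁.2) = z at key
  omega

/-! ### From simplicial complexes to the combinatorial properties. -/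

/-- The inclusion of `ℤ²` into the plane. -/
def toPlane (a : ℤ × ℤ) : ℝ × ℝ := ((a.1 : ℝ), (a.2 : ℝ))

theorem toPlane_injective : Function.Injective toPlane := by
  rintro ⟨a1, a2⟩ ⟨b1, b2⟩ h
  simpa [toPlane] using h

theorem det3_toPlane (a b c : ℤ × ℤ) : det3 (toPlane a) (toPlane b) (toPlane c) = idet a b c := by
  simp [det3, toPlane, idet]

/-- The integer coordinates of the lattice points of `P`. -/
def intPoints (P : Set (ℝ × ℝ)) : Set (ℤ × ℤ) := {a | toPlane a ∈ P}

theorem mem_latticePoints {P : Set (ℝ × ℝ)} {x : ℝ × ℝ} :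
    x ∈ latticePoints P ↔ ∃ a ∈ intPoints P, x = toPlane a := by
  constructor
  · rintro ⟨hx, a, b, rfl⟩
    exact ⟨(a, b), hx, rfl⟩
  · rintro ⟨a, ha, rfl⟩
    exact ⟨ha, a.1, a.2, rfl⟩

/-- The edges of a complex, in integer coordinates. -/
def IsEdge (K : SimplicialComplex ℝ (ℝ × ℝ)) (a b : ℤ × ℤ) : Prop :=
  a ≠ b ∧ {toPlane a, toPlane b} ∈ K.faces

/-- The triangles of a complex, in integer coordinates. -/
def IsTriangle (K : SimplicialComplex ℝ (ℝ × ℝ)) (a b c : ℤ × ℤ) : Prop :=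
  a ≠ b ∧ a ≠ c ∧ b ≠ c ∧ {toPlane a, toPlane b, toPlane c} ∈ K.faces

/-- The lattice points of `P` do not lie on one line. -/
def IsFull (P : Set (ℝ × ℝ)) : Prop := ∀ a b : ℤ × ℤ, a ≠ b → ∃ c ∈ intPoints P, idet a b c ≠ 0

theorem det3_combo (a b x y : ℝ × ℝ) (t : ℝ) :
    det3 a b ((1 - t) • x + t • y) = (1 - t) * det3 a b x + t * det3 a b y := by
  simp only [det3, Prod.fst_add, Prod.snd_add, Prod.smul_fst, Prod.smul_snd, smul_eq_mul]
  ring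

theorem exists_weights_of_mem_convexHull {a b c x : ℝ × ℝ} (h : x ∈ convexHull ℝ {a, b, c}) :
    ∃ α β γ : ℝ, 0 ≤ α ∧ 0 ≤ β ∧ 0 ≤ γ ∧ α + β + γ = 1 ∧ x = α • a + β • b + γ • c := by
  rw [convexHull_insert (Set.insert_nonempty _ _), convexHull_pair, convexJoin_singleton_left] at h
  simp only [Set.mem_iUnion] at h
  obtain ⟨y, ⟨u, v, hu, hv, huv, rfl⟩, u', v', hu', hv', huv', rfl⟩ := h
  refine ⟨u', v' * u, v' * v, hu', mul_nonneg hv' hu, mul_nonneg hv' hv, ?_, ?_⟩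
  · linear_combination v' * huv + huv'
  · rw [smul_add, smul_smul, smul_smul, add_assoc]

theorem card_face_le_three (K : SimplicialComplex ℝ (ℝ × ℝ)) {s : Finset (ℝ × ℝ)}
    (hs : s ∈ K.faces) : s.card ≤ 3 := by
  have h1 := (K.indep hs).card_le_finrank_succ
  have h2 := Submodule.finrank_le (vectorSpan ℝ (Set.range ((↑) : s → ℝ × ℝ)))
  have h3 : Module.finrank ℝ (ℝ × ℝ) = 2 := by simp
  rw [Fintype.card_coe] at h1
  omega

namespace IsUnimodularTriangulation

variable {P : Set (ℝ × ℝ)} {K L : SimplicialComplex ℝ (ℝ × ℝ)}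

theorem exists_intPoint (hK : IsUnimodularTriangulation P K) {s : Finset (ℝ × ℝ)}
    (hs : s ∈ K.faces) {x : ℝ × ℝ} (hx : x ∈ s) : ∃ a ∈ intPoints P, x = toPlane a :=
  mem_latticePoints.1 (hK.vertices_subset
    (K.down_closed hs (Finset.singleton_subset_iff.2 hx) (Finset.singleton_nonempty x)))

theorem face_cases (hK : IsUnimodularTriangulation P K) {s : Finset (ℝ × ℝ)} (hs : s ∈ K.faces) :
    (∃ a, s = {toPlane a}) ∨ (∃ a b, IsEdge K a b ∧ s = {toPlane a, toPlane b}) ∨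
      ∃ a b c, IsTriangle K a b c ∧ s = {toPlane a, toPlane b, toPlane c} := by
  have hpos := Finset.card_pos.2 (K.nonempty_of_mem_faces hs)
  have hle := card_face_le_three K hs
  obtain h | h | h : s.card = 1 ∨ s.card = 2 ∨ s.card = 3 := by omega
  · obtain ⟨x, rfl⟩ := Finset.card_eq_one.1 h
    obtain ⟨a, -, rfl⟩ := hK.exists_intPoint hs (Finset.mem_singleton_self x)
    exact Or.inl ⟨a, rfl⟩
  · obtain ⟨x, y, hxy, rfl⟩ := Finset.card_eq_two.1 h
    obtain ⟨a, -, rfl⟩ := hK.exists_intPoint hs (x := x) (by simp)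
    obtain ⟨b, -, rfl⟩ := hK.exists_intPoint hs (x := y) (by simp)
    exact Or.inr (Or.inl ⟨a, b, ⟨fun h => hxy (by rw [h]), hs⟩, rfl⟩)
  · obtain ⟨x, y, z, hxy, hxz, hyz, rfl⟩ := Finset.card_eq_three.1 h
    obtain ⟨a, -, rfl⟩ := hK.exists_intPoint hs (x := x) (by simp)
    obtain ⟨b, -, rfl⟩ := hK.exists_intPoint hs (x := y) (by simp)
    obtain ⟨c, -, rfl⟩ := hK.exists_intPoint hs (x := z) (by simp)
    exact Or.inr (Or.inr ⟨a, b, c, ⟨fun h => hxy (by rw [h]), fun h => hxz (by rw [h]),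
      fun h => hyz (by rw [h]), hs⟩, rfl⟩)

theorem idet_of_isTriangle (hK : IsUnimodularTriangulation P K) {a b c : ℤ × ℤ}
    (h : IsTriangle K a b c) : idet a b c = 1 ∨ idet a b c = -1 := by
  obtain ⟨hab, hac, hbc, hs⟩ := h
  have h := hK.unimodular _ hs (toPlane a) (by simp) (toPlane b) (by simp) (toPlane c) (by simp)
    (toPlane_injective.ne hab) (toPlane_injective.ne hac) (toPlane_injective.ne hbc)
  rw [det3_toPlane] at h
  have h' : |idet a b c| = 1 := by exact_mod_cast h
  rcases abs_cases (idet a b c) with h | h <;> omega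

theorem finite_faces (hP : Bornology.IsBounded P) (hK : IsUnimodularTriangulation P K) :
    K.faces.Finite := by
  have h1 : {s : Finset (ℝ × ℝ) | (s : Set (ℝ × ℝ)) ⊆ latticePoints P}.Finite :=
    (finite_latticePoints hP).finite_subsets.preimage (Finset.coe_injective.injOn)
  refine h1.subset fun s hs x hx => hK.vertices_subset
    (K.down_closed hs (Finset.singleton_subset_iff.2 hx) (Finset.singleton_nonempty x))

theorem toPlane_mem_space (hK : IsUnimodularTriangulation P K) {a : ℤ × ℤ}
    (ha : a ∈ intPoints P) : toPlane a ∈ K.space := by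
  rw [hK.space_eq]
  exact subset_convexHull _ _ (mem_latticePoints.2 ⟨a, ha, rfl⟩)

theorem convex_space (hK : IsUnimodularTriangulation P K) : Convex ℝ K.space := by
  rw [hK.space_eq]
  exact convex_convexHull _ _

/-- Moving slightly from `x` towards `y` stays in a face containing `x`. -/
theorem exists_face_towards (hP : Bornology.IsBounded P) (hK : IsUnimodularTriangulation P K)
    {x y : ℝ × ℝ} (hx : x ∈ K.space) (hy : y ∈ K.space) :
    ∃ t ∈ K.faces, x ∈ convexHull ℝ (t : Set (ℝ × ℝ)) ∧ ∃ ε : ℝ, 0 < ε ∧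
      (1 - ε) • x + ε • y ∈ convexHull ℝ (t : Set (ℝ × ℝ)) := by
  -- The finitely many faces missing `x` have a closed union, which the points of the segment close
  -- to `x` avoid. A face covering such a point therefore contains `x`.
  set F : Set (Finset (ℝ × ℝ)) := {t ∈ K.faces | x ∉ convexHull ℝ (t : Set (ℝ × ℝ))} with hF
  have hFfin : F.Finite := (hK.finite_faces hP).subset fun t ht => ht.1
  have hclosed : IsClosed (⋃ t ∈ F, convexHull ℝ (t : Set (ℝ × ℝ))) :=
    hFfin.isClosed_biUnion fun t _ => t.finite_toSet.isClosed_convexHull ℝ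
  have hxF : x ∈ (⋃ t ∈ F, convexHull ℝ (t : Set (ℝ × ℝ)))ᶜ := by
    simp only [Set.mem_compl_iff, Set.mem_iUnion, not_exists]
    exact fun t ht => ht.2
  have hcont : Filter.Tendsto (fun ε : ℝ => (1 - ε) • x + ε • y) (nhdsWithin 0 (Set.Ioi 0))
      (nhds x) := by
    have : Continuous (fun ε : ℝ => (1 - ε) • x + ε • y) := by fun_prop
    simpa using (this.tendsto 0).mono_left nhdsWithin_le_nhds
  have h1 := hcont.eventually (hclosed.isOpen_compl.mem_nhds hxF)
  obtain ⟨ε, hε, hε0, hε1⟩ := (h1.and (Ioo_mem_nhdsGT (zero_lt_one' ℝ))).exists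
  have hmem : (1 - ε) • x + ε • y ∈ K.space :=
    hK.convex_space hx hy (by linarith) hε0.le (by ring)
  obtain ⟨t, ht, hxt⟩ := SimplicialComplex.mem_space_iff.1 hmem
  refine ⟨t, ht, ?_, ε, hε0, hxt⟩
  by_contra hcon
  exact hε (Set.mem_biUnion (show t ∈ F from ⟨ht, hcon⟩) hxt)

theorem isEdge_symm {a b : ℤ × ℤ} (h : IsEdge K a b) : IsEdge K b a :=
  ⟨h.1.symm, by rw [Finset.pair_comm]; exact h.2⟩

/-- The midpoint lies in the hull of the common vertices of the edge and the face; with at most one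
common vertex it would coincide with an end. -/
theorem subset_of_midpoint_mem {a b : ℝ × ℝ} (hab : a ≠ b) (he : {a, b} ∈ K.faces)
    {t : Finset (ℝ × ℝ)} (ht : t ∈ K.faces)
    (h : midpoint ℝ a b ∈ convexHull ℝ (t : Set (ℝ × ℝ))) : a ∈ t ∧ b ∈ t := by
  classical
  have hm : midpoint ℝ a b ∈ convexHull ℝ (({a, b} : Finset (ℝ × ℝ)) : Set (ℝ × ℝ)) := by
    rw [Finset.coe_pair, convexHull_pair]
    exact midpoint_mem_segment a b
  have hi := K.inter_subset_convexHull he ht ⟨hm, h⟩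
  by_contra hcon
  have key : ∀ c : ℝ × ℝ, ((({a, b} : Finset (ℝ × ℝ)) : Set (ℝ × ℝ)) ∩ t) ⊆ {c} →
      midpoint ℝ a b = c := by
    intro c hc
    have := convexHull_mono (𝕜 := ℝ) hc hi
    simpa using this
  by_cases ha : a ∈ t
  · have hb : b ∉ t := fun hb => hcon ⟨ha, hb⟩
    refine hab ((midpoint_eq_left_iff (R := ℝ)).1 (key a ?_))
    rintro x ⟨hx, hxt⟩
    simp only [Finset.coe_insert, Finset.coe_singleton, Set.mem_insert_iff,
      Set.mem_singleton_iff] at hx ⊢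
    rcases hx with rfl | rfl
    · rfl
    · exact absurd hxt hb
  · refine hab ((midpoint_eq_right_iff (R := ℝ)).1 (key b ?_))
    rintro x ⟨hx, hxt⟩
    simp only [Finset.coe_insert, Finset.coe_singleton, Set.mem_insert_iff,
      Set.mem_singleton_iff] at hx ⊢
    rcases hx with rfl | rfl
    · exact absurd hxt ha
    · rfl

/-- Move slightly from the midpoint of the edge towards `c`. The face reached contains `a` and `b`,
and it has a point strictly to the left of the edge, hence a vertex there. -/
theorem exists_triangle (hP : Bornology.IsBounded P) (hK : IsUnimodularTriangulation P K)
    {a b c : ℤ × ℤ} (he : IsEdge K a b) (hc : c ∈ intPoints P) (hpos : 0 < idet a b c) :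
    ∃ c', IsTriangle K a b c' ∧ idet a b c' = 1 := by
  have hab := toPlane_injective.ne he.1
  have hm : midpoint ℝ (toPlane a) (toPlane b) ∈ K.space := by
    refine SimplicialComplex.convexHull_subset_space he.2 ?_
    rw [Finset.coe_pair, convexHull_pair]
    exact midpoint_mem_segment _ _
  obtain ⟨t, ht, hmt, ε, hε, hy⟩ := hK.exists_face_towards hP hm (hK.toPlane_mem_space hc)
  obtain ⟨hat, hbt⟩ := subset_of_midpoint_mem hab he.2 ht hmt
  have hdet : 0 < det3 (toPlane a) (toPlane b)
      ((1 - ε) • midpoint ℝ (toPlane a) (toPlane b) + ε • toPlane c) := by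
    have h0 : det3 (toPlane a) (toPlane b) (midpoint ℝ (toPlane a) (toPlane b)) = 0 := by
      rw [midpoint_eq_smul_add]
      simp only [det3, Prod.fst_add, Prod.snd_add, Prod.smul_fst, Prod.smul_snd, smul_eq_mul,
        invOf_eq_inv]
      ring
    rw [det3_combo, h0, det3_toPlane]
    have : (0 : ℝ) < idet a b c := by exact_mod_cast hpos
    simpa using mul_pos hε this
  obtain ⟨x, hxt, hx⟩ : ∃ x ∈ t, 0 < det3 (toPlane a) (toPlane b) x := by
    by_contra! hcon
    have hconv : Convex ℝ {x | det3 (toPlane a) (toPlane b) x ≤ 0} := by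
      intro x hx y hy u v hu hv huv
      have : u = 1 - v := by linarith
      subst this
      simp only [Set.mem_ofPred_eq] at hx hy ⊢
      rw [det3_combo]
      nlinarith
    exact absurd (convexHull_min (fun x hx => hcon x hx) hconv hy) (not_le.2 hdet)
  obtain ⟨c', -, rfl⟩ := hK.exists_intPoint ht hxt
  have hpos' : 0 < idet a b c' := by
    rw [det3_toPlane] at hx
    exact_mod_cast hx
  have hac : a ≠ c' := by rintro rfl; simp [idet] at hpos'
  have hbc : b ≠ c' := by
    rintro rfl
    rw [show idet a b b = 0 by unfold idet; ring] at hpos'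
    exact lt_irrefl _ hpos'
  have htri : IsTriangle K a b c' := by
    refine ⟨he.1, hac, hbc, K.down_closed ht ?_ ⟨toPlane a, by simp⟩⟩
    intro x hx
    simp only [Finset.mem_insert, Finset.mem_singleton] at hx
    rcases hx with rfl | rfl | rfl <;> assumption
  refine ⟨c', htri, ?_⟩
  rcases hK.idet_of_isTriangle htri with h | h <;> omega

/-- A lattice point off the line of the edge provides a triangle on it, whose determinant 1 is a
Bézout relation. -/
theorem coprime_of_isEdge (hP : Bornology.IsBounded P) (hfull : IsFull P)
    (hK : IsUnimodularTriangulation P K) {a b : ℤ × ℤ} (he : IsEdge K a b) :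
    IsCoprime (b.1 - a.1) (b.2 - a.2) := by
  obtain ⟨c, hc, hne⟩ := hfull a b he.1
  rcases lt_or_gt_of_ne hne with h | h
  · obtain ⟨c', -, h'⟩ := hK.exists_triangle hP (isEdge_symm he) hc
      (by rw [idet_swap]; linarith)
    exact ⟨-(c'.2 - b.2), c'.1 - b.1, by rw [← h']; unfold idet; ring⟩
  · obtain ⟨c', -, h'⟩ := hK.exists_triangle hP he hc h
    exact ⟨c'.2 - a.2, -(c'.1 - a.1), by rw [← h']; unfold idet; ring⟩

/-- Every half-integral point of the polygon is a vertex or the midpoint of an edge. -/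
theorem exists_add_eq (hP : Bornology.IsBounded P) (hfull : IsFull P)
    (hK : IsUnimodularTriangulation P K) {s : ℤ × ℤ}
    (hs : ((s.1 : ℝ) / 2, (s.2 : ℝ) / 2) ∈ K.space) :
    (∃ a, {toPlane a} ∈ K.faces ∧ a + a = s) ∨ ∃ a b, IsEdge K a b ∧ a + b = s := by
  obtain ⟨t, ht, hst⟩ := SimplicialComplex.mem_space_iff.1 hs
  have vert : ∀ a, toPlane a ∈ t → {toPlane a} ∈ K.faces := fun a ha =>
    K.down_closed ht (Finset.singleton_subset_iff.2 ha) (Finset.singleton_nonempty _)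
  have edge : ∀ a b, a ≠ b → toPlane a ∈ t → toPlane b ∈ t → IsEdge K a b := fun a b hab ha hb =>
    ⟨hab, K.down_closed ht (Finset.insert_subset ha (Finset.singleton_subset_iff.2 hb))
      (Finset.insert_nonempty _ _)⟩
  rcases hK.face_cases ht with ⟨a, rfl⟩ | ⟨a, b, he, rfl⟩ | ⟨a, b, c, htri, rfl⟩
  · left
    refine ⟨a, ht, ?_⟩
    simp only [Finset.coe_singleton, convexHull_singleton, Set.mem_singleton_iff, toPlane,
      Prod.mk.injEq] at hst
    obtain ⟨h1, h2⟩ := hst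
    ext
    · have : (s.1 : ℝ) = a.1 + a.1 := by linarith
      exact_mod_cast this.symm
    · have : (s.2 : ℝ) = a.2 + a.2 := by linarith
      exact_mod_cast this.symm
  · obtain ⟨u, v, huv⟩ := hK.coprime_of_isEdge hP hfull he
    rw [Finset.coe_pair, convexHull_pair] at hst
    obtain ⟨x, y, hx, hy, hxy, hst⟩ := hst
    have hx' : x = 1 - y := by linarith
    subst hx'
    simp only [toPlane, Prod.smul_mk, smul_eq_mul, Prod.mk_add_mk, Prod.mk.injEq] at hst
    obtain ⟨h1, h2⟩ := hst
    obtain ⟨n, hn⟩ : ∃ n : ℤ, (n : ℝ) = 2 * y := by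
      refine ⟨u * (s.1 - 2 * a.1) + v * (s.2 - 2 * a.2), ?_⟩
      have huv' : (u : ℝ) * (b.1 - a.1) + v * (b.2 - a.2) = 1 := by exact_mod_cast huv
      push_cast
      linear_combination (-2 * (u : ℝ)) * h1 - 2 * (v : ℝ) * h2 + 2 * y * huv'
    have e1 : s.1 = 2 * a.1 + n * (b.1 - a.1) := by
      have : (s.1 : ℝ) = 2 * a.1 + n * (b.1 - a.1) := by rw [hn]; linarith
      exact_mod_cast this
    have e2 : s.2 = 2 * a.2 + n * (b.2 - a.2) := by
      have : (s.2 : ℝ) = 2 * a.2 + n * (b.2 - a.2) := by rw [hn]; linarith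
      exact_mod_cast this
    have n0 : 0 ≤ n := by exact_mod_cast (by linarith : (0 : ℝ) ≤ n)
    have n2 : n ≤ 2 := by exact_mod_cast (by linarith : (n : ℝ) ≤ 2)
    interval_cases n
    · exact Or.inl ⟨a, vert a (by simp),
        by ext <;> simp only [Prod.fst_add, Prod.snd_add] <;> linarith⟩
    · exact Or.inr ⟨a, b, he, by ext <;> simp only [Prod.fst_add, Prod.snd_add] <;> linarith⟩
    · exact Or.inl ⟨b, vert b (by simp),
        by ext <;> simp only [Prod.fst_add, Prod.snd_add] <;> linarith⟩
  · have hε := hK.idet_of_isTriangle htri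
    obtain ⟨hab, hac, hbc, -⟩ := htri
    rw [Finset.coe_insert, Finset.coe_pair] at hst
    obtain ⟨α, β, γ, hα, hβ, hγ, hsum, hst⟩ := exists_weights_of_mem_convexHull hst
    have hα' : α = 1 - β - γ := by linarith
    subst hα'
    simp only [toPlane, Prod.smul_mk, smul_eq_mul, Prod.mk_add_mk, Prod.mk.injEq] at hst
    obtain ⟨h1, h2⟩ := hst
    obtain ⟨ε, hd⟩ : ∃ ε, idet a b c = ε := ⟨_, rfl⟩
    rw [hd] at hε
    have hd' : ((b.1 : ℝ) - a.1) * (c.2 - a.2) - (c.1 - a.1) * (b.2 - a.2) = ε := by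
      rw [← hd]; simp [idet]
    have hε2 : (ε : ℝ) * ε = 1 := by rcases hε with rfl | rfl <;> norm_num
    have f1 : (s.1 : ℝ) - 2 * a.1 = 2 * β * (b.1 - a.1) + 2 * γ * (c.1 - a.1) := by linarith
    have f2 : (s.2 : ℝ) - 2 * a.2 = 2 * β * (b.2 - a.2) + 2 * γ * (c.2 - a.2) := by linarith
    -- By Cramer's rule the doubled barycentric coordinates are integers. Nonnegative with sum 2,
    -- they single out a vertex or the midpoint of a side.
    obtain ⟨n, hn⟩ : ∃ n : ℤ, (n : ℝ) = 2 * β := by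
      refine ⟨ε * ((s.1 - 2 * a.1) * (c.2 - a.2) - (s.2 - 2 * a.2) * (c.1 - a.1)), ?_⟩
      push_cast
      rw [f1, f2]
      linear_combination 2 * β * ε * hd' + 2 * β * hε2
    obtain ⟨m, hm⟩ : ∃ m : ℤ, (m : ℝ) = 2 * γ := by
      refine ⟨ε * ((s.2 - 2 * a.2) * (b.1 - a.1) - (s.1 - 2 * a.1) * (b.2 - a.2)), ?_⟩
      push_cast
      rw [f1, f2]
      linear_combination 2 * γ * ε * hd' + 2 * γ * hε2
    have e1 : s.1 = 2 * a.1 + n * (b.1 - a.1) + m * (c.1 - a.1) := by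
      have : (s.1 : ℝ) = 2 * a.1 + n * (b.1 - a.1) + m * (c.1 - a.1) := by rw [hn, hm]; linarith
      exact_mod_cast this
    have e2 : s.2 = 2 * a.2 + n * (b.2 - a.2) + m * (c.2 - a.2) := by
      have : (s.2 : ℝ) = 2 * a.2 + n * (b.2 - a.2) + m * (c.2 - a.2) := by rw [hn, hm]; linarith
      exact_mod_cast this
    have n0 : 0 ≤ n := by exact_mod_cast (by linarith : (0 : ℝ) ≤ n)
    have m0 : 0 ≤ m := by exact_mod_cast (by linarith : (0 : ℝ) ≤ m)
    have nm : n + m ≤ 2 := by exact_mod_cast (by linarith : (n : ℝ) + m ≤ 2)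
    obtain ⟨rfl, rfl⟩ | ⟨rfl, rfl⟩ | ⟨rfl, rfl⟩ | ⟨rfl, rfl⟩ | ⟨rfl, rfl⟩ | ⟨rfl, rfl⟩ :
        (n = 0 ∧ m = 0) ∨ (n = 1 ∧ m = 0) ∨ (n = 2 ∧ m = 0) ∨ (n = 0 ∧ m = 1) ∨
        (n = 0 ∧ m = 2) ∨ (n = 1 ∧ m = 1) := by omega
    · exact Or.inl ⟨a, vert a (by simp),
        by ext <;> simp only [Prod.fst_add, Prod.snd_add] <;> linarith⟩
    · exact Or.inr ⟨a, b, edge a b hab (by simp) (by simp),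
        by ext <;> simp only [Prod.fst_add, Prod.snd_add] <;> linarith⟩
    · exact Or.inl ⟨b, vert b (by simp),
        by ext <;> simp only [Prod.fst_add, Prod.snd_add] <;> linarith⟩
    · exact Or.inr ⟨a, c, edge a c hac (by simp) (by simp),
        by ext <;> simp only [Prod.fst_add, Prod.snd_add] <;> linarith⟩
    · exact Or.inl ⟨c, vert c (by simp),
        by ext <;> simp only [Prod.fst_add, Prod.snd_add] <;> linarith⟩
    · exact Or.inr ⟨b, c, edge b c hbc (by simp) (by simp),
        by ext <;> simp only [Prod.fst_add, Prod.snd_add] <;> linarith⟩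

/-- With a lattice point as midpoint, the edge vector would be twice a lattice vector, hence not
primitive. -/
theorem not_isEdge_of_even (hP : Bornology.IsBounded P) (hfull : IsFull P)
    (hK : IsUnimodularTriangulation P K) {a b v : ℤ × ℤ} (h : a + b = v + v) : ¬IsEdge K a b := by
  intro he
  obtain ⟨x, y, hxy⟩ := hK.coprime_of_isEdge hP hfull he
  have h1 := congrArg Prod.fst h
  have h2 := congrArg Prod.snd h
  simp only [Prod.fst_add, Prod.snd_add] at h1 h2
  have : 2 * (x * (v.1 - a.1) + y * (v.2 - a.2)) = 1 := by
    have e1 : b.1 = v.1 + v.1 - a.1 := by linarith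
    have e2 : b.2 = v.2 + v.2 - a.2 := by linarith
    rw [e1, e2] at hxy
    linear_combination hxy
  omega

theorem vertex_of_mem (hP : Bornology.IsBounded P) (hfull : IsFull P)
    (hK : IsUnimodularTriangulation P K) {v : ℤ × ℤ} (hv : v ∈ intPoints P) :
    {toPlane v} ∈ K.faces := by
  have hs : ((((v + v).1 : ℤ) : ℝ) / 2, (((v + v).2 : ℤ) : ℝ) / 2) ∈ K.space := by
    convert hK.toPlane_mem_space hv using 1
    simp [toPlane]
  rcases hK.exists_add_eq hP hfull hs with ⟨a, ha, h⟩ | ⟨a, b, he, h⟩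
  · have h1 := congrArg Prod.fst h
    have h2 := congrArg Prod.snd h
    simp only [Prod.fst_add, Prod.snd_add] at h1 h2
    have : a = v := by ext <;> omega
    rwa [← this]
  · exact (hK.not_isEdge_of_even hP hfull h he).elim

/-- Two triangulations of the same polygon have edges at the same midpoints. -/
theorem exists_isEdge_add_eq (hP : Bornology.IsBounded P) (hfull : IsFull P)
    (hK : IsUnimodularTriangulation P K) (hL : IsUnimodularTriangulation P L) {a b : ℤ × ℤ}
    (he : IsEdge K a b) : ∃ a' b', IsEdge L a' b' ∧ a' + b' = a + b := by
  have hs : ((((a + b).1 : ℤ) : ℝ) / 2, (((a + b).2 : ℤ) : ℝ) / 2) ∈ L.space := by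
    rw [hL.space_eq, ← hK.space_eq]
    refine SimplicialComplex.convexHull_subset_space he.2 ?_
    rw [Finset.coe_pair, convexHull_pair]
    convert midpoint_mem_segment (𝕜 := ℝ) (toPlane a) (toPlane b) using 1
    rw [midpoint_eq_smul_add]
    ext <;> simp [toPlane] <;> ring
  rcases hL.exists_add_eq hP hfull hs with ⟨v, -, h⟩ | h
  · exact (hK.not_isEdge_of_even hP hfull h.symm he).elim
  · exact h

/-- The crossing point lies in both edges, hence in the hull of their common vertices. There are
none, because a shared end would make one of the determinants vanish. -/
theorem not_cross {a b c d : ℤ × ℤ} (he : IsEdge K a b) (he' : IsEdge K c d)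
    (h₁ : idet a b c * idet a b d < 0) (h₂ : idet c d a * idet c d b < 0) : False := by
  have h₁' : (idet a b c : ℝ) * idet a b d < 0 := by exact_mod_cast h₁
  have h₂' : (idet c d a : ℝ) * idet c d b < 0 := by exact_mod_cast h₂
  -- `x / (x - y)` is the parameter at which an affine function with end values `x` and `y`
  -- vanishes.
  have frac : ∀ x y : ℝ, x * y < 0 → x - y ≠ 0 ∧ 0 ≤ x / (x - y) ∧ 0 ≤ 1 - x / (x - y) := by
    intro x y hxy
    rcases lt_or_gt_of_ne (show x ≠ 0 by rintro rfl; simp at hxy) with hx | hx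
    · have hy : 0 < y := by nlinarith
      have hne : x - y < 0 := by linarith
      refine ⟨hne.ne, div_nonneg_of_nonpos hx.le hne.le, ?_⟩
      rw [one_sub_div hne.ne]
      exact div_nonneg_of_nonpos (by linarith) hne.le
    · have hy : y < 0 := by nlinarith
      have hne : 0 < x - y := by linarith
      refine ⟨hne.ne', div_nonneg hx.le hne.le, ?_⟩
      rw [one_sub_div hne.ne']
      exact div_nonneg (by linarith) hne.le
  obtain ⟨hu, hu0, hu1⟩ := frac _ _ h₁'
  obtain ⟨ht, ht0, ht1⟩ := frac _ _ h₂'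
  have hx₁ : (1 - (idet c d a : ℝ) / (idet c d a - idet c d b)) • toPlane a +
      ((idet c d a : ℝ) / (idet c d a - idet c d b)) • toPlane b ∈
      convexHull ℝ (({toPlane a, toPlane b} : Finset (ℝ × ℝ)) : Set (ℝ × ℝ)) := by
    rw [Finset.coe_pair, convexHull_pair]
    exact ⟨_, _, ht1, ht0, by ring, rfl⟩
  have hx₂ : (1 - (idet a b c : ℝ) / (idet a b c - idet a b d)) • toPlane c +
      ((idet a b c : ℝ) / (idet a b c - idet a b d)) • toPlane d ∈
      convexHull ℝ (({toPlane c, toPlane d} : Finset (ℝ × ℝ)) : Set (ℝ × ℝ)) := by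
    rw [Finset.coe_pair, convexHull_pair]
    exact ⟨_, _, hu1, hu0, by ring, rfl⟩
  have heq : (1 - (idet c d a : ℝ) / (idet c d a - idet c d b)) • toPlane a +
      ((idet c d a : ℝ) / (idet c d a - idet c d b)) • toPlane b =
      (1 - (idet a b c : ℝ) / (idet a b c - idet a b d)) • toPlane c +
      ((idet a b c : ℝ) / (idet a b c - idet a b d)) • toPlane d := by
    have hsum : ((idet c d a : ℝ) - idet c d b) = idet a b d - idet a b c := by
      simp only [idet]; push_cast; ring
    have hne : (idet a b d : ℝ) - idet a b c ≠ 0 := by rw [← hsum]; exact ht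
    rw [hsum, one_sub_div hne, one_sub_div hu]
    ext
    · simp only [toPlane, Prod.fst_add, Prod.smul_fst, smul_eq_mul]
      field_simp
      simp only [idet]; push_cast; ring
    · simp only [toPlane, Prod.snd_add, Prod.smul_snd, smul_eq_mul]
      field_simp
      simp only [idet]; push_cast; ring
  rw [← heq] at hx₂
  have hi := K.inter_subset_convexHull he.2 he'.2 ⟨hx₁, hx₂⟩
  have hempty : ((({toPlane a, toPlane b} : Finset (ℝ × ℝ)) : Set (ℝ × ℝ)) ∩
      (({toPlane c, toPlane d} : Finset (ℝ × ℝ)) : Set (ℝ × ℝ))) = ∅ := by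
    rw [Set.eq_empty_iff_forall_notMem]
    rintro x ⟨hx, hx'⟩
    have hself : ∀ x y : ℤ × ℤ, idet x y x = 0 ∧ idet x y y = 0 := fun x y => by
      constructor <;> (unfold idet; ring)
    simp only [Finset.coe_insert, Finset.coe_singleton, Set.mem_insert_iff,
      Set.mem_singleton_iff] at hx hx'
    rcases hx with rfl | rfl <;> rcases hx' with h | h <;>
      obtain rfl := toPlane_injective h <;> simp [hself] at h₁
  rw [hempty] at hi
  simp at hi

end IsUnimodularTriangulation
theorem IsTriangle.rotate {K : SimplicialComplex ℝ (ℝ × ℝ)} {a b c : ℤ × ℤ}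
    (h : IsTriangle K a b c) : IsTriangle K b c a := by
  obtain ⟨h1, h2, h3, h4⟩ := h
  refine ⟨h3, h1.symm, h2.symm, ?_⟩
  convert h4 using 1
  ext x; simp only [Finset.mem_insert, Finset.mem_singleton]; tauto

theorem IsTriangle.swap {K : SimplicialComplex ℝ (ℝ × ℝ)} {a b c : ℤ × ℤ}
    (h : IsTriangle K a b c) : IsTriangle K b a c := by
  obtain ⟨h1, h2, h3, h4⟩ := h
  exact ⟨h1.symm, h3, h2, by rwa [Finset.insert_comm]⟩

theorem IsTriangle.isEdge {K : SimplicialComplex ℝ (ℝ × ℝ)} {a b c : ℤ × ℤ}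
    (h : IsTriangle K a b c) : IsEdge K a b := by
  refine ⟨h.1, K.down_closed h.2.2.2 ?_ (Finset.insert_nonempty _ _)⟩
  intro x
  simp only [Finset.mem_insert, Finset.mem_singleton]
  tauto

/-- A primitive vector that is a positive multiple of another one equals it. -/
theorem eq_of_ray {p b q : ℤ × ℤ} (hb : IsCoprime (b.1 - p.1) (b.2 - p.2))
    (hq : IsCoprime (q.1 - p.1) (q.2 - p.2)) {ε y : ℝ} (hε : 0 < ε) (hy : 0 ≤ y)
    (h1 : ε * ((q.1 : ℝ) - p.1) = y * (b.1 - p.1)) (h2 : ε * ((q.2 : ℝ) - p.2) = y * (b.2 - p.2)) :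
    b = q := by
  obtain ⟨u, v, huv⟩ := hb
  obtain ⟨u', v', huv'⟩ := hq
  have hdet : (q.1 - p.1) * (b.2 - p.2) = (q.2 - p.2) * (b.1 - p.1) := by
    have : ((q.1 : ℝ) - p.1) * (b.2 - p.2) = (q.2 - p.2) * (b.1 - p.1) := by
      refine mul_left_cancel₀ hε.ne' ?_
      linear_combination (b.2 - p.2 : ℝ) * h1 - (b.1 - p.1 : ℝ) * h2
    exact_mod_cast this
  set k := u * (q.1 - p.1) + v * (q.2 - p.2) with hk
  have hk1 : q.1 - p.1 = k * (b.1 - p.1) := by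
    linear_combination (-(q.1 - p.1)) * huv + v * hdet
  have hk2 : q.2 - p.2 = k * (b.2 - p.2) := by
    linear_combination (-(q.2 - p.2)) * huv - u * hdet
  have hunit : k * (u' * (b.1 - p.1) + v' * (b.2 - p.2)) = 1 := by
    rw [hk1, hk2] at huv'; linarith
  rcases Int.eq_one_or_neg_one_of_mul_eq_one hunit with h | h <;> rw [h] at hk1 hk2
  · ext <;> omega
  · have e1 : (q.1 : ℝ) - p.1 = -1 * (b.1 - p.1) := by exact_mod_cast hk1
    have e2 : (q.2 : ℝ) - p.2 = -1 * (b.2 - p.2) := by exact_mod_cast hk2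
    rw [e1] at h1
    rw [e2] at h2
    have z1 : (b.1 : ℝ) - p.1 = 0 := by
      have : (ε + y) * ((b.1 : ℝ) - p.1) = 0 := by linarith
      exact (mul_eq_zero.1 this).resolve_left (by linarith)
    have z2 : (b.2 : ℝ) - p.2 = 0 := by
      have : (ε + y) * ((b.2 : ℝ) - p.2) = 0 := by linarith
      exact (mul_eq_zero.1 this).resolve_left (by linarith)
    have z1' : b.1 - p.1 = 0 := by exact_mod_cast z1
    have z2' : b.2 - p.2 = 0 := by exact_mod_cast z2
    rw [z1', z2'] at huv
    simp at huv

namespace IsUnimodularTriangulation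

variable {P : Set (ℝ × ℝ)} {K L : SimplicialComplex ℝ (ℝ × ℝ)}

theorem face_cases_of_mem (hK : IsUnimodularTriangulation P K) {s : Finset (ℝ × ℝ)}
    (hs : s ∈ K.faces) {p : ℤ × ℤ} (hp : toPlane p ∈ s) :
    s = {toPlane p} ∨ (∃ b, IsEdge K p b ∧ s = {toPlane p, toPlane b}) ∨
      ∃ b c, IsTriangle K p b c ∧ s = {toPlane p, toPlane b, toPlane c} := by
  rcases hK.face_cases hs with ⟨a, rfl⟩ | ⟨a, b, he, rfl⟩ | ⟨a, b, c, ht, rfl⟩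
  · rw [Finset.mem_singleton] at hp
    exact Or.inl (by rw [hp])
  · right; left
    simp only [Finset.mem_insert, Finset.mem_singleton, toPlane_injective.eq_iff] at hp
    rcases hp with rfl | rfl
    · exact ⟨b, he, rfl⟩
    · exact ⟨a, isEdge_symm he, Finset.pair_comm _ _⟩
  · right; right
    simp only [Finset.mem_insert, Finset.mem_singleton, toPlane_injective.eq_iff] at hp
    rcases hp with rfl | rfl | rfl
    · exact ⟨b, c, ht, rfl⟩
    · exact ⟨a, c, ht.swap, Finset.insert_comm _ _ _⟩
    · refine ⟨a, b, ht.rotate.rotate, ?_⟩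
      ext x; simp only [Finset.mem_insert, Finset.mem_singleton]; tauto

/-- A small move from `p` towards `q` stays in a face having `p` as a vertex. If it runs along an
edge, primitivity makes `q` the other end; otherwise it enters the cone of a triangle. -/
theorem edge_or_cone (hP : Bornology.IsBounded P) (hfull : IsFull P)
    (hK : IsUnimodularTriangulation P K) {p q : ℤ × ℤ} (hp : p ∈ intPoints P)
    (hq : q ∈ intPoints P) (hpq : IsCoprime (q.1 - p.1) (q.2 - p.2)) :
    IsEdge K p q ∨ ∃ a h, IsTriangle K p a h ∧ idet p a h = 1 ∧ 0 < idet p a q ∧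
      0 < idet p q h := by
  obtain ⟨t, ht, hpt, ε, hε, hy⟩ :=
    hK.exists_face_towards hP (hK.toPlane_mem_space hp) (hK.toPlane_mem_space hq)
  replace hpt := (SimplicialComplex.vertex_mem_convexHull_iff
    (SimplicialComplex.mem_vertices.2 (hK.vertex_of_mem hP hfull hp)) ht).1 hpt
  have edge : ∀ b, IsEdge K p b → ∀ y : ℝ, 0 ≤ y → ε * ((q.1 : ℝ) - p.1) = y * (b.1 - p.1) →
      ε * ((q.2 : ℝ) - p.2) = y * (b.2 - p.2) → IsEdge K p q := by
    intro b hb y hy h1 h2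
    rwa [← eq_of_ray (hK.coprime_of_isEdge hP hfull hb) hpq hε hy h1 h2]
  have tri : ∀ b c, IsTriangle K p b c → ∀ β γ : ℝ, 0 < β → 0 < γ →
      ε * ((q.1 : ℝ) - p.1) = β * (b.1 - p.1) + γ * (c.1 - p.1) →
      ε * ((q.2 : ℝ) - p.2) = β * (b.2 - p.2) + γ * (c.2 - p.2) → idet p b c = 1 →
      ∃ a h, IsTriangle K p a h ∧ idet p a h = 1 ∧ 0 < idet p a q ∧ 0 < idet p q h := by
    intro b c hT β γ hβ hγ h1 h2 hd
    have hd' : ((b.1 : ℝ) - p.1) * (c.2 - p.2) - (c.1 - p.1) * (b.2 - p.2) = 1 := by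
      exact_mod_cast hd
    refine ⟨b, c, hT, hd, ?_, ?_⟩
    · have : ε * (idet p b q : ℝ) = γ := by
        simp only [idet]; push_cast
        linear_combination (b.1 - p.1 : ℝ) * h2 - (b.2 - p.2 : ℝ) * h1 + γ * hd'
      exact_mod_cast pos_of_mul_pos_right (this ▸ hγ) hε.le
    · have : ε * (idet p q c : ℝ) = β := by
        simp only [idet]; push_cast
        linear_combination (c.2 - p.2 : ℝ) * h1 - (c.1 - p.1 : ℝ) * h2 + β * hd'
      exact_mod_cast pos_of_mul_pos_right (this ▸ hβ) hε.le
  rcases hK.face_cases_of_mem ht hpt with rfl | ⟨b, hb, rfl⟩ | ⟨b, c, hT, rfl⟩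
  · left
    simp only [Finset.coe_singleton, convexHull_singleton, Set.mem_singleton_iff, toPlane,
      Prod.smul_mk, smul_eq_mul, Prod.mk_add_mk, Prod.mk.injEq] at hy
    obtain ⟨u, v, huv⟩ := hpq
    have huv' : (u : ℝ) * (q.1 - p.1) + v * (q.2 - p.2) = 1 := by exact_mod_cast huv
    exfalso
    have : ε = 0 := by linear_combination (u : ℝ) * hy.1 + (v : ℝ) * hy.2 - ε * huv'
    exact hε.ne' this
  · left
    rw [Finset.coe_pair, convexHull_pair] at hy
    obtain ⟨x, y, hx, hy0, hxy, hy⟩ := hy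
    have hx' : x = 1 - y := by linarith
    subst hx'
    simp only [toPlane, Prod.smul_mk, smul_eq_mul, Prod.mk_add_mk, Prod.mk.injEq] at hy
    exact edge b hb y hy0 (by linarith [hy.1]) (by linarith [hy.2])
  · rw [Finset.coe_insert, Finset.coe_pair] at hy
    obtain ⟨α, β, γ, hα, hβ, hγ, hsum, hy⟩ := exists_weights_of_mem_convexHull hy
    have hα' : α = 1 - β - γ := by linarith
    subst hα'
    simp only [toPlane, Prod.smul_mk, smul_eq_mul, Prod.mk_add_mk, Prod.mk.injEq] at hy
    have h1 : ε * ((q.1 : ℝ) - p.1) = β * (b.1 - p.1) + γ * (c.1 - p.1) := by linarith [hy.1]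
    have h2 : ε * ((q.2 : ℝ) - p.2) = β * (b.2 - p.2) + γ * (c.2 - p.2) := by linarith [hy.2]
    rcases hβ.eq_or_lt with rfl | hβ
    · exact Or.inl (edge c hT.rotate.rotate.swap.isEdge γ hγ (by linarith) (by linarith))
    rcases hγ.eq_or_lt with rfl | hγ
    · exact Or.inl (edge b hT.isEdge β hβ.le (by linarith) (by linarith))
    right
    rcases hK.idet_of_isTriangle hT with hd | hd
    · exact tri b c hT β γ hβ hγ h1 h2 hd
    · refine tri c b hT.swap.rotate γ β hγ hβ (by linarith) (by linarith) ?_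
      rw [show idet p c b = -idet p b c by unfold idet; ring, hd]; rfl

theorem isLatticeTriangulation (hP : Bornology.IsBounded P) (hfull : IsFull P)
    (hK : IsUnimodularTriangulation P K) :
    IsLatticeTriangulation (intPoints P) (IsEdge K) (IsTriangle K) where
  mem {a b} h := by
    obtain ⟨a', ha', h'⟩ := hK.exists_intPoint h.2 (x := toPlane a) (by simp)
    rwa [toPlane_injective h']
  symm := isEdge_symm
  rotate := IsTriangle.rotate
  swap := IsTriangle.swap
  edge := IsTriangle.isEdge
  unimodular := hK.idet_of_isTriangle
  coprime := hK.coprime_of_isEdge hP hfull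
  not_cross := not_cross
  extend := hK.exists_triangle hP
  direction := hK.edge_or_cone hP hfull

theorem faces_subset_of_isEdge_iff (hP : Bornology.IsBounded P) (hfull : IsFull P)
    (hK : IsUnimodularTriangulation P K) (hL : IsUnimodularTriangulation P L)
    (h : ∀ a b, IsEdge K a b ↔ IsEdge L a b) : K.faces ⊆ L.faces := by
  intro s hs
  rcases hK.face_cases hs with ⟨a, rfl⟩ | ⟨a, b, he, rfl⟩ | ⟨a, b, c, ht, rfl⟩
  · obtain ⟨a', ha', h'⟩ := hK.exists_intPoint hs (x := toPlane a) (by simp)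
    rw [h']
    exact hL.vertex_of_mem hP hfull ha'
  · exact ((h a b).1 he).2
  · exact ((hK.isLatticeTriangulation hP hfull).triangle_of_edges
      (hL.isLatticeTriangulation hP hfull) h ht).2.2.2

/-- A unimodular triangulation is determined by its edges. -/
theorem eq_of_isEdge_iff (hP : Bornology.IsBounded P) (hfull : IsFull P)
    (hK : IsUnimodularTriangulation P K) (hL : IsUnimodularTriangulation P L)
    (h : ∀ a b, IsEdge K a b ↔ IsEdge L a b) : K = L :=
  SimplicialComplex.ext (Set.Subset.antisymm (hK.faces_subset_of_isEdge_iff hP hfull hL h)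
    (hL.faces_subset_of_isEdge_iff hP hfull hK fun a b => (h a b).symm))

end IsUnimodularTriangulation
-- At most two choices per midpoint.
/-- If among any three elements of `F` agreeing on all earlier positions two agree at the
next position, then `F` has at most `2 ^ |M|` elements. -/
theorem card_le_two_pow_of_branching {α σ β : Type*} [DecidableEq σ] (w : σ → ℤ) (g : α → σ → β)
    (M : Finset σ) (F : Finset α)
    (hinj : ∀ x ∈ F, ∀ y ∈ F, (∀ s ∈ M, g x s = g y s) → x = y)
    (h3 : ∀ s ∈ M, ∀ x ∈ F, ∀ y ∈ F, ∀ z ∈ F, (∀ s' ∈ M, w s' < w s → g x s' = g y s') →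
      (∀ s' ∈ M, w s' < w s → g x s' = g z s') → g x s = g y s ∨ g x s = g z s ∨ g y s = g z s) :
    F.card ≤ 2 ^ M.card := by
  classical
  induction M using Finset.induction_on_min_value w generalizing F with
  | empty =>
    simp only [Finset.card_empty, pow_zero]
    exact Finset.card_le_one.2 fun x hx y hy => hinj x hx y hy (by simp)
  | insert a M ha hmin ih =>
    rcases F.eq_empty_or_nonempty with rfl | ⟨x₀, hx₀⟩
    · simp
    have part : ∀ G ⊆ F, (∀ x ∈ G, ∀ y ∈ G, g x a = g y a) → G.card ≤ 2 ^ M.card := by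
      intro G hG hGa
      refine ih G (fun x hx y hy h => hinj x (hG hx) y (hG hy) ?_) ?_
      · intro s hs
        rcases Finset.mem_insert.1 hs with rfl | hs
        · exact hGa x hx y hy
        · exact h s hs
      · intro s hs x hx y hy z hz hxy hxz
        refine h3 s (Finset.mem_insert_of_mem hs) x (hG hx) y (hG hy) z (hG hz) ?_ ?_
        · intro s' hs' hlt
          rcases Finset.mem_insert.1 hs' with rfl | hs'
          · exact hGa x hx y hy
          · exact hxy s' hs' hlt
        · intro s' hs' hlt
          rcases Finset.mem_insert.1 hs' with rfl | hs'
          · exact hGa x hx z hz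
          · exact hxz s' hs' hlt
    -- Nothing precedes the minimal position `a`, so `h3` applies there unconditionally: elements
    -- that differ from `x₀` at `a` agree with each other. Hence there are two classes.
    have h1 := part (F.filter fun x => g x a = g x₀ a) (Finset.filter_subset _ _) (by
      intro x hx y hy
      rw [(Finset.mem_filter.1 hx).2, (Finset.mem_filter.1 hy).2])
    have h2 := part (F.filter fun x => ¬g x a = g x₀ a) (Finset.filter_subset _ _) (by
      intro x hx y hy
      obtain ⟨hx, hxa⟩ := Finset.mem_filter.1 hx
      obtain ⟨hy, hya⟩ := Finset.mem_filter.1 hy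
      have vac : ∀ z, ∀ s' ∈ insert a M, w s' < w a → g x₀ s' = g z s' := by
        intro z s' hs' hlt
        rcases Finset.mem_insert.1 hs' with rfl | hs'
        · exact absurd hlt (lt_irrefl _)
        · exact absurd hlt (not_lt.2 (hmin s' hs'))
      rcases h3 a (Finset.mem_insert_self _ _) x₀ hx₀ x hx y hy (vac x) (vac y) with h | h | h
      · exact absurd h.symm hxa
      · exact absurd h.symm hya
      · exact h)
    rw [← Finset.card_filter_add_card_filter_not (s := F) fun x => g x a = g x₀ a,
      Finset.card_insert_of_notMem ha, pow_succ]
    omega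

theorem IsLatticeTriangulation.eq_or_eq_of_add_eq {V : Set (ℤ × ℤ)} {E : ℤ × ℤ → ℤ × ℤ → Prop}
    {T : ℤ × ℤ → ℤ × ℤ → ℤ × ℤ → Prop} (hT : IsLatticeTriangulation V E T) {a b c d : ℤ × ℤ}
    (h₁ : E a b) (h₂ : E c d) (hs : a + b = c + d) : (a = c ∧ b = d) ∨ (a = d ∧ b = c) := by
  by_cases h0 : idet a b c = 0
  · exact IsLatticeTriangulation.eq_of_collinear (hT.coprime h₁) (hT.coprime h₂) hs h0
  · obtain ⟨i1, i2, i3⟩ := idet_of_add_eq hs.symm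
    refine (hT.not_cross h₁ h₂ ?_ ?_).elim
    · rw [i3]
      linarith [mul_self_pos.2 h0]
    · rw [i1, i2]
      linarith [mul_self_pos.2 h0]

variable {P : Set (ℝ × ℝ)} {K L : SimplicialComplex ℝ (ℝ × ℝ)}

/-- The ends of the edges with midpoint `s / 2`. -/
def endsAt (K : SimplicialComplex ℝ (ℝ × ℝ)) (s : ℤ × ℤ) : Set (ℤ × ℤ) := {a | IsEdge K a (s - a)}

theorem isEdge_iff_of_endsAt_eq {a b : ℤ × ℤ} (h : endsAt K (a + b) = endsAt L (a + b)) :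
    IsEdge K a b ↔ IsEdge L a b := by
  have := Set.ext_iff.1 h a
  simpa [endsAt] using this

theorem IsUnimodularTriangulation.endsAt_eq (hP : Bornology.IsBounded P) (hfull : IsFull P)
    (hK : IsUnimodularTriangulation P K) {a b : ℤ × ℤ} (he : IsEdge K a b) :
    endsAt K (a + b) = {a, b} := by
  ext x
  simp only [endsAt, Set.mem_ofPred_eq, Set.mem_insert_iff, Set.mem_singleton_iff]
  constructor
  · intro hx
    rcases (hK.isLatticeTriangulation hP hfull).eq_or_eq_of_add_eq hx he (by abel) with h | h
    · exact Or.inl h.1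
    · exact Or.inr h.1
  · rintro (rfl | rfl)
    · simpa using he
    · simpa using IsUnimodularTriangulation.isEdge_symm he

/-- A family of unimodular triangulations whose edges are determined, in the order of `f`, by
those with midpoints in `M / 2` has at most `2 ^ |M|` members. -/
theorem ncard_le_two_pow (hP : Bornology.IsBounded P) (hfull : IsFull P) (f : ℤ × ℤ →ₗ[ℤ] ℤ)
    (hf : ∀ a ∈ intPoints P, ∀ b ∈ intPoints P, ∀ c ∈ intPoints P, ∀ d ∈ intPoints P,
      f (a + b) = f (c + d) → a + b = c + d)
    (F : Set (SimplicialComplex ℝ (ℝ × ℝ))) (hF : ∀ K ∈ F, IsUnimodularTriangulation P K)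
    (M : Finset (ℤ × ℤ))
    (hM : ∀ K ∈ F, ∀ L ∈ F, ∀ a b, IsEdge K a b →
      (∀ x y, x + y ∈ M → f (x + y) ≤ f (a + b) → (IsEdge K x y ↔ IsEdge L x y)) → IsEdge L a b) :
    F.ncard ≤ 2 ^ M.card := by
  have hfin : F.Finite := (finite_triangulations hP).subset hF
  rw [Set.ncard_eq_toFinset_card F hfin]
  -- `C` is an initial segment of levels: all of them for injectivity, those below `f s` for the
  -- branching condition.
  have det : ∀ K ∈ F, ∀ L ∈ F, ∀ C : ℤ → Prop, (∀ m n, m ≤ n → C n → C m) →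
      (∀ s ∈ M, C (f s) → endsAt K s = endsAt L s) →
      ∀ a b, C (f (a + b)) → (IsEdge K a b ↔ IsEdge L a b) := by
    intro K hK L hL C hC h a b hab
    have h' : ∀ x y, x + y ∈ M → f (x + y) ≤ f (a + b) → (IsEdge K x y ↔ IsEdge L x y) :=
      fun x y hxy hle => isEdge_iff_of_endsAt_eq (h _ hxy (hC _ _ hle hab))
    exact ⟨fun he => hM K hK L hL a b he h',
      fun he => hM L hL K hK a b he fun x y hxy hle => (h' x y hxy hle).symm⟩
  refine card_le_two_pow_of_branching (fun s => f s) endsAt M hfin.toFinset ?_ ?_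
  · intro K hK L hL h
    rw [Set.Finite.mem_toFinset] at hK hL
    exact (hF K hK).eq_of_isEdge_iff hP hfull (hF L hL) fun a b =>
      det K hK L hL (fun _ => True) (fun _ _ _ _ => trivial) (fun s hs _ => h s hs) a b trivial
  · intro s hs K hK L hL J hJ hKL hKJ
    rw [Set.Finite.mem_toFinset] at hK hL hJ
    by_contra! hne
    obtain ⟨hne₁, hne₂, hne₃⟩ := hne
    have hlow : ∀ K ∈ F, ∀ L ∈ F, (∀ s' ∈ M, f s' < f s → endsAt K s' = endsAt L s') →
        ∀ a b, f (a + b) < f s → (IsEdge K a b ↔ IsEdge L a b) := fun K hK L hL h =>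
      det K hK L hL (fun n => n < f s) (fun m n hmn hn => lt_of_le_of_lt hmn hn) h
    obtain ⟨p₁, q₁, e₁, s₁⟩ : ∃ a b, IsEdge K a b ∧ a + b = s := by
      by_contra! hno
      refine hne₁ ?_
      have hK0 : endsAt K s = ∅ := Set.eq_empty_of_forall_notMem fun a ha => hno a _ ha (by abel)
      rw [hK0, eq_comm]
      refine Set.eq_empty_of_forall_notMem fun a ha => ?_
      obtain ⟨a', b', h, hs'⟩ := (hF L hL).exists_isEdge_add_eq hP hfull (hF K hK) ha
      exact hno a' b' h (by rw [hs']; abel)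
    obtain ⟨p₂, q₂, e₂, s₂⟩ := (hF K hK).exists_isEdge_add_eq hP hfull (hF L hL) e₁
    obtain ⟨p₃, q₃, e₃, s₃⟩ := (hF K hK).exists_isEdge_add_eq hP hfull (hF J hJ) e₁
    rw [s₁] at s₂ s₃
    have pair : ∀ K ∈ F, ∀ L ∈ F, ∀ p q p' q', IsEdge K p q → IsEdge L p' q' → p + q = s →
        p' + q' = s → endsAt K s ≠ endsAt L s →
        (∀ s' ∈ M, f s' < f s → endsAt K s' = endsAt L s') →
        idet p q p' = 1 ∨ idet p q p' = -1 := by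
      intro K hK L hL p q p' q' e e' hs hs' hne h
      have TK := (hF K hK).isLatticeTriangulation hP hfull
      have TL := (hF L hL).isLatticeTriangulation hP hfull
      refine TL.cross TK f hf e e' (hs'.trans hs.symm) (fun a b hab => ?_) fun h0 => hne ?_
      · exact (hlow K hK L hL h a b (hs ▸ hab)).symm
      · have h1 := (hF K hK).endsAt_eq hP hfull e
        have h2 := (hF L hL).endsAt_eq hP hfull e'
        rw [hs] at h1
        rw [hs'] at h2
        rw [h1, h2]
        rcases IsLatticeTriangulation.eq_of_collinear (TK.coprime e) (TL.coprime e')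
          (hs.trans hs'.symm) h0 with ⟨rfl, rfl⟩ | ⟨rfl, rfl⟩
        · rfl
        · exact Set.pair_comm _ _
    -- Three different edges at `s` would be pairwise diagonals of unimodular parallelograms.
    exact not_three_diagonals (s₂.trans s₁.symm)
      (pair K hK L hL p₁ q₁ p₂ q₂ e₁ e₂ s₁ s₂ hne₁ hKL)
      (pair K hK J hJ p₁ q₁ p₃ q₃ e₁ e₃ s₁ s₃ hne₂ hKJ)
      (pair L hL J hJ p₂ q₂ p₃ q₃ e₂ e₃ s₂ s₃ hne₃
        fun s' hs' hlt => (hKL s' hs' hlt).symm.trans (hKJ s' hs' hlt))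

/-- Boundary edges are common to all unimodular triangulations. -/
theorem isEdge_of_boundary (hP : Bornology.IsBounded P) (hfull : IsFull P)
    (hK : IsUnimodularTriangulation P K) (hL : IsUnimodularTriangulation P L) {u v k : ℤ}
    (huv : u ≠ 0 ∨ v ≠ 0) (hk : ∀ a ∈ intPoints P, k ≤ u * a.1 + v * a.2) {a b : ℤ × ℤ}
    (he : IsEdge K a b) (hab : u * (a + b).1 + v * (a + b).2 = 2 * k) : IsEdge L a b := by
  have TK := hK.isLatticeTriangulation hP hfull
  have TL := hL.isLatticeTriangulation hP hfull
  obtain ⟨c, d, he', hs⟩ := hK.exists_isEdge_add_eq hP hfull hL he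
  have ka := hk a (TK.mem he)
  have kb := hk b (TK.mem (TK.symm he))
  have kc := hk c (TL.mem he')
  have kd := hk d (TL.mem (TL.symm he'))
  have hcd := hab
  rw [← hs] at hcd
  simp only [Prod.fst_add, Prod.snd_add] at hab hcd
  -- Both sums attain the minimum `2 k`, so all four ends lie on the supporting line.
  have h1 : u * (b.1 - a.1) + v * (b.2 - a.2) = 0 := by nlinarith
  have h2 : u * (c.1 - a.1) + v * (c.2 - a.2) = 0 := by nlinarith
  have h0 : idet a b c = 0 := by
    rcases huv with hu | hv
    · refine (mul_eq_zero.1 (?_ : u * idet a b c = 0)).resolve_left hu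
      unfold idet
      linear_combination (c.2 - a.2) * h1 - (b.2 - a.2) * h2
    · refine (mul_eq_zero.1 (?_ : v * idet a b c = 0)).resolve_left hv
      unfold idet
      linear_combination (b.1 - a.1) * h2 - (c.1 - a.1) * h1
  rcases IsLatticeTriangulation.eq_of_collinear (TK.coprime he) (TL.coprime he') hs.symm h0 with
    ⟨rfl, rfl⟩ | ⟨rfl, rfl⟩
  · exact he'
  · exact TL.symm he'

/-! ### The two triangles, the sweep order and the number of midpoints. -/

theorem combo_mem_convexHull_triple {a b c : ℝ × ℝ} {α β γ : ℝ} (hα : 0 ≤ α) (hβ : 0 ≤ β)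
    (hγ : 0 ≤ γ) (h : α + β + γ = 1) :
    α • a + β • b + γ • c ∈ convexHull ℝ ({a, b, c} : Set (ℝ × ℝ)) := by
  have hc := convex_convexHull ℝ ({a, b, c} : Set (ℝ × ℝ))
  have hsub := subset_convexHull ℝ ({a, b, c} : Set (ℝ × ℝ))
  have := hc.sum_mem (t := Finset.univ) (w := ![α, β, γ]) (z := ![a, b, c])
    (by intro i _; fin_cases i <;> simpa) (by simp [Fin.sum_univ_three, h])
    (by intro i _; fin_cases i <;> exact hsub (by simp))
  simpa [Fin.sum_univ_three] using this

theorem mem_dilatedTriangle {d : ℕ} (hd : 1 ≤ d) {x : ℝ × ℝ} :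
    x ∈ dilatedTriangle d ↔ 0 ≤ x.1 ∧ 0 ≤ x.2 ∧ x.1 + x.2 ≤ d := by
  have hd' : (0 : ℝ) < d := by exact_mod_cast hd
  constructor
  · intro h
    obtain ⟨α, β, γ, hα, hβ, hγ, hsum, rfl⟩ := exists_weights_of_mem_convexHull h
    simp only [Prod.smul_mk, smul_eq_mul, Prod.mk_add_mk]
    refine ⟨by nlinarith, by nlinarith, by nlinarith⟩
  · rintro ⟨h1, h2, h3⟩
    have := combo_mem_convexHull_triple (a := ((0 : ℝ), (0 : ℝ))) (b := ((d : ℝ), (0 : ℝ)))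
      (c := ((0 : ℝ), (d : ℝ))) (α := (d - x.1 - x.2) / d) (β := x.1 / d) (γ := x.2 / d)
      (div_nonneg (by linarith) hd'.le) (div_nonneg h1 hd'.le) (div_nonneg h2 hd'.le)
      (by field_simp; ring)
    rw [dilatedTriangle]
    convert this using 1
    ext <;> simp only [Prod.fst_add, Prod.snd_add, Prod.smul_fst, Prod.smul_snd, smul_eq_mul] <;>
      field_simp <;> ring

theorem mem_halfTriangle {d : ℕ} (hd : 1 ≤ d) {x : ℝ × ℝ} :
    x ∈ halfTriangle d ↔ 0 ≤ x.2 ∧ x.2 ≤ x.1 ∧ x.1 + x.2 ≤ d := by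
  have hd' : (0 : ℝ) < d := by exact_mod_cast hd
  constructor
  · intro h
    obtain ⟨α, β, γ, hα, hβ, hγ, hsum, rfl⟩ := exists_weights_of_mem_convexHull h
    simp only [Prod.smul_mk, smul_eq_mul, Prod.mk_add_mk]
    refine ⟨by nlinarith, by nlinarith, by nlinarith⟩
  · rintro ⟨h1, h2, h3⟩
    have := combo_mem_convexHull_triple (a := ((0 : ℝ), (0 : ℝ)))
      (b := ((d : ℝ) / 2, (d : ℝ) / 2)) (c := ((d : ℝ), (0 : ℝ))) (α := (d - x.1 - x.2) / d)
      (β := 2 * x.2 / d) (γ := (x.1 - x.2) / d)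
      (div_nonneg (by linarith) hd'.le) (div_nonneg (by linarith) hd'.le)
      (div_nonneg (by linarith) hd'.le) (by field_simp; ring)
    rw [halfTriangle]
    convert this using 1
    ext <;> simp only [Prod.fst_add, Prod.snd_add, Prod.smul_fst, Prod.smul_snd, smul_eq_mul] <;>
      field_simp <;> ring

theorem mem_intPoints_dilatedTriangle {d : ℕ} (hd : 1 ≤ d) {a : ℤ × ℤ} :
    a ∈ intPoints (dilatedTriangle d) ↔ 0 ≤ a.1 ∧ 0 ≤ a.2 ∧ a.1 + a.2 ≤ d := by
  rw [intPoints, Set.mem_ofPred_eq, mem_dilatedTriangle hd]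
  simp only [toPlane]
  norm_cast

theorem mem_intPoints_halfTriangle {d : ℕ} (hd : 1 ≤ d) {a : ℤ × ℤ} :
    a ∈ intPoints (halfTriangle d) ↔ 0 ≤ a.2 ∧ a.2 ≤ a.1 ∧ a.1 + a.2 ≤ d := by
  rw [intPoints, Set.mem_ofPred_eq, mem_halfTriangle hd]
  simp only [toPlane]
  norm_cast

theorem isBounded_dilatedTriangle (d : ℕ) : Bornology.IsBounded (dilatedTriangle d) :=
  isBounded_convexHull.2 (Set.toFinite _).isBounded

theorem isBounded_halfTriangle (d : ℕ) : Bornology.IsBounded (halfTriangle d) :=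
  isBounded_convexHull.2 (Set.toFinite _).isBounded

theorem isFull_of_three {P : Set (ℝ × ℝ)} {x y z : ℤ × ℤ} (hx : x ∈ intPoints P)
    (hy : y ∈ intPoints P) (hz : z ∈ intPoints P) (h : idet x y z = 1) : IsFull P := by
  intro a b hab
  by_contra! hcon
  have h1 := hcon x hx
  have h2 := hcon y hy
  have h3 := hcon z hz
  unfold idet at h h1 h2 h3
  have e1 : (b.1 - a.1) * (y.2 - x.2) = (b.2 - a.2) * (y.1 - x.1) := by linarith
  have e2 : (b.1 - a.1) * (z.2 - x.2) = (b.2 - a.2) * (z.1 - x.1) := by linarith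
  refine hab ?_
  ext
  · linear_combination (b.1 - a.1) * h + (z.1 - x.1) * e1 - (y.1 - x.1) * e2
  · linear_combination (b.2 - a.2) * h + (z.2 - x.2) * e1 - (y.2 - x.2) * e2

theorem isFull_dilatedTriangle {d : ℕ} (hd : 1 ≤ d) : IsFull (dilatedTriangle d) := by
  refine isFull_of_three (x := (0, 0)) (y := (1, 0)) (z := (0, 1)) ?_ ?_ ?_ (by simp [idet]) <;>
    rw [mem_intPoints_dilatedTriangle hd] <;> simp <;> exact_mod_cast hd

/-- For `d = 1` the only lattice points are `(0, 0)` and `(1, 0)`; `halfCount_one_le` treats that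
case. -/
theorem isFull_halfTriangle {d : ℕ} (hd : 2 ≤ d) : IsFull (halfTriangle d) := by
  refine isFull_of_three (x := (0, 0)) (y := (1, 0)) (z := (1, 1)) ?_ ?_ ?_ (by simp [idet]) <;>
    rw [mem_intPoints_halfTriangle (by omega)] <;> simp <;> omega

/-- The order on midpoints: by `x + y`, then by `y`. -/
def sweep (d : ℕ) : ℤ × ℤ →ₗ[ℤ] ℤ :=
  (2 * d + 1 : ℤ) • (LinearMap.fst ℤ ℤ ℤ + LinearMap.snd ℤ ℤ ℤ) + LinearMap.snd ℤ ℤ ℤ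

theorem sweep_apply (d : ℕ) (a : ℤ × ℤ) : sweep d a = (2 * d + 1) * (a.1 + a.2) + a.2 := by
  simp [sweep]; ring

/-- The second coordinate of a doubled midpoint is at most `2 d`, so the factor `2 d + 1` makes the
order lexicographic. -/
theorem eq_of_sweep_eq {d : ℕ} {a b : ℤ × ℤ} (ha : 0 ≤ a.2 ∧ a.2 ≤ 2 * d)
    (hb : 0 ≤ b.2 ∧ b.2 ≤ 2 * d) (h : sweep d a = sweep d b) : a = b := by
  rw [sweep_apply, sweep_apply] at h
  have h1 : a.1 + a.2 = b.1 + b.2 := by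
    by_contra hne
    rcases lt_or_gt_of_ne hne with hlt | hlt <;> nlinarith
  rw [h1] at h
  ext <;> linarith

/-- The doubled midpoints in the open half-triangle. -/
def midpoints (d : ℕ) : Finset (ℤ × ℤ) :=
  (Finset.range d).biUnion fun r =>
    -- On `x + y = 2r + 1` every `0 < y < x` counts, giving `r` points. On `x + y = 2r` both
    -- coordinates must be odd, giving `r / 2`.
    (Finset.Icc 1 r).image (fun j : ℕ => ((2 * r + 1 - j : ℤ), (j : ℤ))) ∪
      (Finset.range (r / 2)).image fun t : ℕ => ((2 * r - (2 * t + 1) : ℤ), (2 * t + 1 : ℤ))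

/-- The doubled midpoints on the axis of symmetry. -/
def axisMidpoints (d : ℕ) : Finset (ℤ × ℤ) :=
  (Finset.range (d / 2)).image fun t : ℕ => ((2 * t + 1 : ℤ), (2 * t + 1 : ℤ))

theorem mem_midpoints {d : ℕ} {s : ℤ × ℤ} (h0 : 0 < s.2) (h1 : s.2 < s.1) (h2 : s.1 + s.2 < 2 * d)
    (hodd : ¬∃ v, s = v + v) : s ∈ midpoints d := by
  obtain ⟨x, y⟩ := s
  simp only at h0 h1 h2
  lift y to ℕ using h0.le
  have hx : 0 ≤ x := by omega
  lift x to ℕ using hx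
  simp only [midpoints, Finset.mem_biUnion, Finset.mem_range, Finset.mem_union, Finset.mem_image,
    Finset.mem_Icc, Prod.mk.injEq]
  rcases Nat.even_or_odd' (x + y) with ⟨r, hr | hr⟩
  · refine ⟨r, by omega, Or.inr ⟨y / 2, ?_⟩⟩
    have hy : y % 2 = 1 := by
      by_contra hy
      refine hodd ⟨((x / 2 : ℕ), (y / 2 : ℕ)), ?_⟩
      simp only [Prod.mk_add_mk, Prod.mk.injEq]
      constructor <;> omega
    refine ⟨by omega, by omega, by omega⟩
  · exact ⟨r, by omega, Or.inl ⟨y, by omega, by omega, rfl⟩⟩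

theorem mem_axisMidpoints {d : ℕ} {s : ℤ × ℤ} (h0 : 0 < s.2) (h1 : s.2 = s.1)
    (h2 : s.1 + s.2 < 2 * d) (hodd : ¬∃ v, s = v + v) : s ∈ axisMidpoints d := by
  obtain ⟨x, y⟩ := s
  simp only at h0 h1 h2
  subst h1
  lift y to ℕ using h0.le
  simp only [axisMidpoints, Finset.mem_range, Finset.mem_image, Prod.mk.injEq]
  have hy : y % 2 = 1 := by
    by_contra hy
    refine hodd ⟨((y / 2 : ℕ), (y / 2 : ℕ)), ?_⟩
    simp only [Prod.mk_add_mk, Prod.mk.injEq]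
    constructor <;> omega
  exact ⟨y / 2, by omega, by omega, by omega⟩

theorem card_axisMidpoints_le (d : ℕ) : (axisMidpoints d).card ≤ d / 2 :=
  Finset.card_image_le.trans (by simp)

theorem card_midpoints_le (d : ℕ) :
    (midpoints d).card ≤ ∑ r ∈ Finset.range d, (r + r / 2) := by
  refine Finset.card_biUnion_le.trans (Finset.sum_le_sum fun r _ => ?_)
  refine (Finset.card_union_le _ _).trans (add_le_add ?_ ?_)
  · exact Finset.card_image_le.trans (by simp)
  · exact Finset.card_image_le.trans (by simp)

theorem sum_range_add_half (e : ℕ) :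
    ∑ r ∈ Finset.range (2 * e), (r + r / 2) + 2 * e = 3 * e ^ 2 := by
  induction e with
  | zero => simp
  | succ e ih =>
    rw [show 2 * (e + 1) = 2 * e + 1 + 1 by ring, Finset.sum_range_succ, Finset.sum_range_succ]
    have h1 : 2 * e / 2 = e := by omega
    have h2 : (2 * e + 1) / 2 = e := by omega
    rw [h1, h2]
    nlinarith

theorem two_pow_card_midpoints_le {d : ℕ} (hd : 1 ≤ d) :
    (2 : ℝ) ^ (midpoints d).card ≤ U d := by
  have hcard := card_midpoints_le d
  rw [← Real.rpow_natCast, U]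
  rcases Nat.even_or_odd' d with ⟨e, rfl | rfl⟩
  · rw [if_pos (even_two_mul e)]
    refine Real.rpow_le_rpow_of_exponent_le one_le_two ?_
    have h := sum_range_add_half e
    have : (((midpoints (2 * e)).card + 2 * e : ℕ) : ℝ) ≤ ((3 * e ^ 2 : ℕ) : ℝ) := by
      exact_mod_cast (by omega)
    push_cast at this ⊢
    linarith
  · rw [if_neg (by simp)]
    refine Real.rpow_le_rpow_of_exponent_le one_le_two ?_
    have h := sum_range_add_half e
    rw [Finset.sum_range_succ, show 2 * e / 2 = e by omega] at hcard
    have : (((midpoints (2 * e + 1)).card : ℕ) : ℝ) ≤ ((3 * e ^ 2 + e : ℕ) : ℝ) := by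
      exact_mod_cast (by omega)
    push_cast at this ⊢
    -- For odd `d = 2e + 1` the count `3e² + e` is below the exponent `3e² + 5e` of `U d`; for even
    -- `d` the bound on the count equals the exponent.
    have he : (0 : ℝ) ≤ e := Nat.cast_nonneg e
    linarith

/-! ### The upper bounds. -/

theorem halfCount_le_of_two_le {d : ℕ} (hd : 2 ≤ d) : halfCount d ≤ 2 ^ (midpoints d).card := by
  have hd1 : 1 ≤ d := by omega
  have hP := isBounded_halfTriangle d
  have hfull := isFull_halfTriangle hd
  refine ncard_le_two_pow hP hfull (sweep d) ?_ _ (fun K hK => hK) (midpoints d) ?_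
  · intro a ha b hb c hc e he h
    rw [mem_intPoints_halfTriangle hd1] at ha hb hc he
    refine eq_of_sweep_eq ?_ ?_ h <;> simp only [Prod.snd_add] <;> omega
  · intro K hK L hL a b he h
    have T := IsUnimodularTriangulation.isLatticeTriangulation hP hfull hK
    have ha := (mem_intPoints_halfTriangle hd1).1 (T.mem he)
    have hb := (mem_intPoints_halfTriangle hd1).1 (T.mem (T.symm he))
    have bd := fun u v k => isEdge_of_boundary (u := u) (v := v) (k := k) hP hfull hK hL
    simp only [mem_intPoints_halfTriangle hd1] at bd
    by_cases h0 : (a + b).2 = 0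
    · exact bd 0 1 0 (by simp) (fun a ha => by omega) he (by omega)
    by_cases h1 : (a + b).2 = (a + b).1
    · exact bd 1 (-1) 0 (by simp) (fun a ha => by omega) he (by omega)
    by_cases h2 : (a + b).1 + (a + b).2 = 2 * d
    · exact bd (-1) (-1) (-d) (by simp) (fun a ha => by omega) he (by omega)
    refine (h a b (mem_midpoints ?_ ?_ ?_ ?_) le_rfl).1 he
    · simp only [Prod.snd_add] at *; omega
    · simp only [Prod.snd_add, Prod.fst_add] at *; omega
    · simp only [Prod.snd_add, Prod.fst_add] at *; omega
    · rintro ⟨v, hv⟩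
      exact IsUnimodularTriangulation.not_isEdge_of_even hP hfull hK hv he

theorem IsSymmetric.isEdge_swap {K : SimplicialComplex ℝ (ℝ × ℝ)} (hK : IsSymmetric K)
    {a b : ℤ × ℤ} (h : IsEdge K a b) : IsEdge K a.swap b.swap := by
  refine ⟨fun hab => h.1 (Prod.swap_injective hab), ?_⟩
  simpa [toPlane] using hK _ h.2

/-- The axis is now interior, so its midpoints count as well. Symmetry lets edges with midpoint
above the axis be read off from their mirror images. -/
theorem symCount_le {d : ℕ} (hd : 1 ≤ d) :
    symCount d ≤ 2 ^ (axisMidpoints d ∪ midpoints d).card := by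
  have hP := isBounded_dilatedTriangle d
  have hfull := isFull_dilatedTriangle hd
  refine ncard_le_two_pow hP hfull (sweep d) ?_ _ (fun K hK => hK.1) _ ?_
  · intro a ha b hb c hc e he h
    rw [mem_intPoints_dilatedTriangle hd] at ha hb hc he
    refine eq_of_sweep_eq ?_ ?_ h <;> simp only [Prod.snd_add] <;> omega
  · rintro K ⟨hK, hKs⟩ L ⟨hL, hLs⟩ a b he h
    have T := IsUnimodularTriangulation.isLatticeTriangulation hP hfull hK
    have bd := fun u v k => isEdge_of_boundary (u := u) (v := v) (k := k) hP hfull hK hL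
    simp only [mem_intPoints_dilatedTriangle hd] at bd
    have low : ∀ a b, IsEdge K a b → (a + b).2 ≤ (a + b).1 →
        (∀ x y, x + y ∈ axisMidpoints d ∪ midpoints d → sweep d (x + y) ≤ sweep d (a + b) →
          (IsEdge K x y ↔ IsEdge L x y)) → IsEdge L a b := by
      intro a b he hle h
      have ha := (mem_intPoints_dilatedTriangle hd).1 (T.mem he)
      have hb := (mem_intPoints_dilatedTriangle hd).1 (T.mem (T.symm he))
      by_cases h0 : (a + b).2 = 0
      · exact bd 0 1 0 (by simp) (fun a ha => by omega) he (by omega)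
      by_cases h2 : (a + b).1 + (a + b).2 = 2 * d
      · exact bd (-1) (-1) (-d) (by simp) (fun a ha => by omega) he (by omega)
      have hodd : ¬∃ v, a + b = v + v := by
        rintro ⟨v, hv⟩
        exact IsUnimodularTriangulation.not_isEdge_of_even hP hfull hK hv he
      refine (h a b (Finset.mem_union.2 ?_) le_rfl).1 he
      by_cases h1 : (a + b).2 = (a + b).1
      · refine Or.inl (mem_axisMidpoints ?_ h1 ?_ hodd) <;>
          simp only [Prod.snd_add, Prod.fst_add] at * <;> omega
      · refine Or.inr (mem_midpoints ?_ ?_ ?_ hodd) <;>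
          simp only [Prod.snd_add, Prod.fst_add] at * <;> omega
    rcases le_or_gt (a + b).2 (a + b).1 with hle | hgt
    · exact low a b he hle h
    · have hsw : ∀ x y : ℤ × ℤ, x.swap + y.swap = (x + y).swap := fun _ _ => rfl
      -- Reflection keeps `x + y` and lowers `y`, so the mirror image comes earlier and what is
      -- known up to `a + b` suffices for it.
      have := low a.swap b.swap (hKs.isEdge_swap he) (by rw [hsw]; exact hgt.le)
        fun x y hxy hle => h x y hxy (hle.trans ?_)
      · simpa using hLs.isEdge_swap this
      · rw [hsw, sweep_apply, sweep_apply]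
        simp only [Prod.fst_swap, Prod.snd_swap]
        nlinarith

/-- The complex must be the full segment: the face covering the midpoint of the two lattice points
contains both. -/
theorem halfCount_one_le : halfCount 1 ≤ 1 := by
  have hlat : ∀ a : ℤ × ℤ, a ∈ intPoints (halfTriangle 1) ↔ a = (0, 0) ∨ a = (1, 0) := by
    intro a
    rw [mem_intPoints_halfTriangle le_rfl]
    obtain ⟨x, y⟩ := a
    simp only [Prod.mk.injEq]
    push_cast
    omega
  have key : ∀ K, IsUnimodularTriangulation (halfTriangle 1) K → ∀ s : Finset (ℝ × ℝ),
      s ∈ K.faces ↔ s.Nonempty ∧ s ⊆ {toPlane (0, 0), toPlane (1, 0)} := by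
    intro K hK s
    have hsub : ∀ s ∈ K.faces, s ⊆ {toPlane (0, 0), toPlane (1, 0)} := by
      intro s hs x hx
      obtain ⟨a, ha, rfl⟩ := hK.exists_intPoint hs hx
      rcases (hlat a).1 ha with rfl | rfl <;> simp
    refine ⟨fun hs => ⟨K.nonempty_of_mem_faces hs, hsub s hs⟩, fun ⟨hne, hs⟩ => ?_⟩
    have hmid : midpoint ℝ (toPlane (0, 0)) (toPlane (1, 0)) ∈ K.space :=
      hK.convex_space.midpoint_mem (hK.toPlane_mem_space ((hlat _).2 (Or.inl rfl)))
        (hK.toPlane_mem_space ((hlat _).2 (Or.inr rfl)))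
    have hinj : toPlane (0, 0) ≠ toPlane (1, 0) := toPlane_injective.ne (by simp)
    obtain ⟨t, ht, hmt⟩ := SimplicialComplex.mem_space_iff.1 hmid
    refine K.down_closed ht (hs.trans ?_) hne
    have hts := hsub t ht
    by_contra hnot
    obtain ⟨v, hv⟩ : ∃ v, t ⊆ {v} ∧ (v = toPlane (0, 0) ∨ v = toPlane (1, 0)) := by
      by_cases h0 : toPlane (0, 0) ∈ t
      · refine ⟨toPlane (0, 0), fun x hx => ?_, Or.inl rfl⟩
        have := hts hx
        simp only [Finset.mem_insert, Finset.mem_singleton] at this ⊢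
        rcases this with rfl | rfl
        · rfl
        · exact (hnot (Finset.insert_subset h0 (Finset.singleton_subset_iff.2 hx))).elim
      · refine ⟨toPlane (1, 0), fun x hx => ?_, Or.inr rfl⟩
        have := hts hx
        simp only [Finset.mem_insert, Finset.mem_singleton] at this ⊢
        rcases this with rfl | rfl
        · exact absurd hx h0
        · rfl
    have hm : midpoint ℝ (toPlane (0, 0)) (toPlane (1, 0)) = v := by
      have := convexHull_mono (𝕜 := ℝ) (Finset.coe_subset.2 hv.1) hmt
      simpa using this
    rcases hv.2 with rfl | rfl
    · exact hinj ((midpoint_eq_left_iff (R := ℝ)).1 hm)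
    · exact hinj ((midpoint_eq_right_iff (R := ℝ)).1 hm)
  refine (Set.ncard_le_one (finite_halfTriangle 1)).2 fun K hK L hL => ?_
  refine SimplicialComplex.ext (Set.ext fun s => ?_)
  rw [key K hK, key L hL]

theorem halfCount_le_U {d : ℕ} (hd : 1 ≤ d) : (halfCount d : ℝ) ≤ U d := by
  refine le_trans ?_ (two_pow_card_midpoints_le hd)
  rcases hd.eq_or_lt with rfl | hd2
  · exact le_trans (by exact_mod_cast halfCount_one_le) (one_le_pow₀ one_le_two)
  · exact_mod_cast halfCount_le_of_two_le hd2

theorem symCount_le_U {d : ℕ} (hd : 1 ≤ d) : (symCount d : ℝ) ≤ 2 ^ (d / 2) * U d := by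
  have h1 : (symCount d : ℝ) ≤ 2 ^ (axisMidpoints d ∪ midpoints d).card := by
    exact_mod_cast symCount_le hd
  refine h1.trans ?_
  calc (2 : ℝ) ^ (axisMidpoints d ∪ midpoints d).card
      ≤ 2 ^ (d / 2 + (midpoints d).card) := pow_le_pow_right₀ one_le_two
        ((Finset.card_union_le _ _).trans (Nat.add_le_add_right (card_axisMidpoints_le d) _))
    _ = 2 ^ (d / 2) * 2 ^ (midpoints d).card := pow_add _ _ _
    _ ≤ 2 ^ (d / 2) * U d :=
        mul_le_mul_of_nonneg_left (two_pow_card_midpoints_le hd) (by positivity)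

theorem U_le {d : ℕ} (hd : 1 ≤ d) :
    U d ≤ (2 : ℝ) ^ (3 / 4 * (d : ℝ) ^ 2 + (d : ℝ) - 3 / 4) := by
  have hd' : (1 : ℝ) ≤ d := by exact_mod_cast hd
  unfold U
  split_ifs <;> exact Real.rpow_le_rpow_of_exponent_le one_le_two (by linarith)

theorem two_pow_mul_U_le {d : ℕ} (hd : 1 ≤ d) :
    2 ^ (d / 2) * U d ≤ (2 : ℝ) ^ (3 * (d : ℝ) ^ 2) := by
  have hd' : (1 : ℝ) ≤ d := by exact_mod_cast hd
  have h1 : (2 : ℝ) ^ (d / 2) ≤ (2 : ℝ) ^ (d : ℝ) := by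
    rw [Real.rpow_natCast]
    exact pow_le_pow_right₀ one_le_two (Nat.div_le_self d 2)
  calc 2 ^ (d / 2) * U d
      ≤ (2 : ℝ) ^ (d : ℝ) * (2 : ℝ) ^ (3 / 4 * (d : ℝ) ^ 2 + (d : ℝ) - 3 / 4) := by
        refine mul_le_mul h1 (U_le hd) ?_ (by positivity)
        unfold U
        split_ifs <;> positivity
    _ = (2 : ℝ) ^ ((d : ℝ) + (3 / 4 * (d : ℝ) ^ 2 + (d : ℝ) - 3 / 4)) :=
        (Real.rpow_add two_pos _ _).symm
    _ ≤ _ := Real.rpow_le_rpow_of_exponent_le one_le_two (by nlinarith)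

/-! ### Hat functions of grid triangulations. -/

open Classical in
/-- The hat function of a vertex of a grid triangulation, on one quadrant around the vertex;
`T` says whether the diagonal of the square in that quadrant starts at the vertex. -/
noncomputable def tent (T : Prop) (p q : ℝ) : ℝ :=
  if T then max 0 (1 - max |p| |q|) else max 0 (1 - |p| - |q|)

/-- The two shapes agree on the axes, so it does not matter to which quadrant a point there is
assigned. -/
theorem tent_axis {T : Prop} {p q : ℝ} (h : p = 0 ∨ q = 0) :
    tent T p q = max 0 (1 - |p| - |q|) := by
  unfold tent
  split_ifs
  · rcases h with rfl | rfl <;> simp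
  · rfl

theorem tent_far {T : Prop} {p q : ℝ} (h : 1 ≤ |p| ∨ 1 ≤ |q|) : tent T p q = 0 := by
  have hp := abs_nonneg p
  have hq := abs_nonneg q
  unfold tent
  split_ifs <;> refine max_eq_left ?_
  · rcases h with h | h
    · linarith [le_max_left |p| |q|]
    · linarith [le_max_right |p| |q|]
  · rcases h with h | h <;> linarith

/-- The value of the hat function from the barycentric coordinates in the square: `α` is the weight
of the vertex itself, `δ` that of the opposite corner. -/
theorem tent_eq_weight {T : Prop} {p q α β γ δ : ℝ} (hα : 0 ≤ α) (hβ : 0 ≤ β) (hγ : 0 ≤ γ)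
    (hδ : 0 ≤ δ) (h : α + β + γ + δ = 1) (hp : |p| = β + δ) (hq : |q| = γ + δ)
    (hT : p ≠ 0 → q ≠ 0 → ((T ∧ (β = 0 ∨ γ = 0)) ∨ (¬T ∧ (α = 0 ∨ δ = 0)))) :
    tent T p q = α := by
  by_cases h0 : p = 0 ∨ q = 0
  · rw [tent_axis h0, hp, hq]
    have : δ = 0 := by
      rcases h0 with rfl | rfl
      · rw [abs_zero] at hp; linarith
      · rw [abs_zero] at hq; linarith
    rw [max_eq_right] <;> linarith
  · push Not at h0
    unfold tent
    rcases hT h0.1 h0.2 with ⟨hT, h1⟩ | ⟨hT, h1⟩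
    · rw [if_pos hT, hp, hq]
      rcases h1 with rfl | rfl
      · rw [max_eq_right (a := 0 + δ) (by linarith), max_eq_right] <;> linarith
      · rw [max_eq_left (b := 0 + δ) (by linarith), max_eq_right] <;> linarith
    · rw [if_neg hT, hp, hq]
      rcases h1 with rfl | rfl
      · rw [max_eq_left]; linarith
      · rw [max_eq_right] <;> linarith

/-- The hat functions of the grid triangulation in which the squares with lower left corner in `C`
have their ascending diagonal, the other ones their descending diagonal. -/
noncomputable def hat (C : ℤ × ℤ → Prop) (v : ℤ × ℤ) (x : ℝ × ℝ) : ℝ :=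
  tent ((0 ≤ x.1 - v.1 ∧ 0 ≤ x.2 - v.2 ∧ C v) ∨
    (x.1 - v.1 ≤ 0 ∧ x.2 - v.2 ≤ 0 ∧ C (v.1 - 1, v.2 - 1)) ∨
    (x.1 - v.1 ≤ 0 ∧ 0 ≤ x.2 - v.2 ∧ ¬C (v.1 - 1, v.2)) ∨
    (0 ≤ x.1 - v.1 ∧ x.2 - v.2 ≤ 0 ∧ ¬C (v.1, v.2 - 1))) (x.1 - v.1) (x.2 - v.2)

/-- The weights belong to the corners of the square at `o`. One corner off the chosen diagonal has
weight zero, so `x` lies in one of the two triangles, where the hat functions are the barycentric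
coordinates. -/
theorem hat_eq_weight (C : ℤ × ℤ → Prop) (o : ℤ × ℤ) {x : ℝ × ℝ} {α β γ δ : ℝ} (hα : 0 ≤ α)
    (hβ : 0 ≤ β) (hγ : 0 ≤ γ) (hδ : 0 ≤ δ) (h : α + β + γ + δ = 1) (h1 : x.1 = o.1 + (β + δ))
    (h2 : x.2 = o.2 + (γ + δ)) (hC : C o → β = 0 ∨ γ = 0) (hnC : ¬C o → α = 0 ∨ δ = 0) :
    hat C o x = α ∧ hat C (o.1 + 1, o.2) x = β ∧ hat C (o.1, o.2 + 1) x = γ ∧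
      hat C (o.1 + 1, o.2 + 1) x = δ := by
  have key : (C o ∧ (β = 0 ∨ γ = 0)) ∨ (¬C o ∧ (α = 0 ∨ δ = 0)) := by
    by_cases hc : C o
    · exact Or.inl ⟨hc, hC hc⟩
    · exact Or.inr ⟨hc, hnC hc⟩
  refine ⟨?_, ?_, ?_, ?_⟩ <;> unfold hat
  · have e1 : x.1 - (o.1 : ℝ) = β + δ := by linarith
    have e2 : x.2 - (o.2 : ℝ) = γ + δ := by linarith
    rw [e1, e2]
    refine tent_eq_weight hα hβ hγ hδ h (abs_of_nonneg (by linarith))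
      (abs_of_nonneg (by linarith)) fun hp hq => ?_
    have hp' : ¬β + δ ≤ 0 := fun hle => hp (by linarith)
    have hq' : ¬γ + δ ≤ 0 := fun hle => hq (by linarith)
    have i1 : 0 ≤ β + δ := by linarith
    have i2 : 0 ≤ γ + δ := by linarith
    simpa [hp', hq', i1, i2] using key
  · have e1 : x.1 - ((o.1 + 1 : ℤ) : ℝ) = -(α + γ) := by push_cast; linarith
    have e2 : x.2 - (o.2 : ℝ) = δ + γ := by linarith
    simp only [e1, e2]
    refine tent_eq_weight hβ hα hδ hγ (by linarith)
      (by rw [abs_neg]; exact abs_of_nonneg (by linarith))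
      (abs_of_nonneg (by linarith)) fun hp hq => ?_
    have hp' : ¬0 ≤ -(α + γ) := fun hle => hp (by linarith)
    have hq' : ¬δ + γ ≤ 0 := fun hle => hq (by linarith)
    have i1 : -(α + γ) ≤ 0 := by linarith
    have i2 : 0 ≤ δ + γ := by linarith
    simp only [hp', hq', i1, i2, add_sub_cancel_right, false_and, true_and, false_or, or_false]
    rcases key with ⟨h, h'⟩ | ⟨h, h'⟩
    · exact Or.inr ⟨not_not.2 h, h'⟩
    · exact Or.inl ⟨h, h'⟩
  · have e1 : x.1 - (o.1 : ℝ) = δ + β := by linarith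
    have e2 : x.2 - ((o.2 + 1 : ℤ) : ℝ) = -(α + β) := by push_cast; linarith
    simp only [e1, e2]
    refine tent_eq_weight hγ hδ hα hβ (by linarith) (abs_of_nonneg (by linarith))
      (by rw [abs_neg]; exact abs_of_nonneg (by linarith)) fun hp hq => ?_
    have hp' : ¬δ + β ≤ 0 := fun hle => hp (by linarith)
    have hq' : ¬0 ≤ -(α + β) := fun hle => hq (by linarith)
    have i1 : 0 ≤ δ + β := by linarith
    have i2 : -(α + β) ≤ 0 := by linarith
    simp only [hp', hq', i1, i2, add_sub_cancel_right, false_and, true_and, false_or]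
    rcases key with ⟨h, h'⟩ | ⟨h, h'⟩
    · exact Or.inr ⟨not_not.2 h, h'.symm⟩
    · exact Or.inl ⟨h, h'.symm⟩
  · have e1 : x.1 - ((o.1 + 1 : ℤ) : ℝ) = -(γ + α) := by push_cast; linarith
    have e2 : x.2 - ((o.2 + 1 : ℤ) : ℝ) = -(β + α) := by push_cast; linarith
    simp only [e1, e2]
    refine tent_eq_weight hδ hγ hβ hα (by linarith)
      (by rw [abs_neg]; exact abs_of_nonneg (by linarith))
      (by rw [abs_neg]; exact abs_of_nonneg (by linarith)) fun hp hq => ?_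
    have hp' : ¬0 ≤ -(γ + α) := fun hle => hp (by linarith)
    have hq' : ¬0 ≤ -(β + α) := fun hle => hq (by linarith)
    have i1 : -(γ + α) ≤ 0 := by linarith
    have i2 : -(β + α) ≤ 0 := by linarith
    simp only [hp', hq', i1, i2, add_sub_cancel_right, false_and, true_and, false_or, or_false]
    rcases key with ⟨h, h'⟩ | ⟨h, h'⟩
    · exact Or.inl ⟨h, h'.symm⟩
    · exact Or.inr ⟨h, h'.symm⟩

theorem hat_eq_zero (C : ℤ × ℤ → Prop) {o v : ℤ × ℤ} {x : ℝ × ℝ} (h1 : (o.1 : ℝ) ≤ x.1)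
    (h2 : x.1 ≤ o.1 + 1) (h3 : (o.2 : ℝ) ≤ x.2) (h4 : x.2 ≤ o.2 + 1)
    (hv : ¬((v.1 = o.1 ∨ v.1 = o.1 + 1) ∧ (v.2 = o.2 ∨ v.2 = o.2 + 1))) : hat C v x = 0 := by
  refine tent_far ?_
  have far : ∀ (m n : ℤ) (y : ℝ), (m : ℝ) ≤ y → y ≤ m + 1 → ¬(n = m ∨ n = m + 1) →
      1 ≤ |y - n| := by
    intro m n y hm hm' hn
    rcases lt_or_ge n m with hlt | hge
    · have : (n : ℝ) + 1 ≤ m := by exact_mod_cast hlt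
      exact le_trans (by linarith) (le_abs_self _)
    · have : (m : ℝ) + 2 ≤ n := by exact_mod_cast (by omega : m + 2 ≤ n)
      exact le_trans (by linarith) (neg_le_abs _)
  by_cases h : v.1 = o.1 ∨ v.1 = o.1 + 1
  · exact Or.inr (far _ _ _ h3 h4 fun h' => hv ⟨h, h'⟩)
  · exact Or.inl (far _ _ _ h1 h2 h)

/-! ### Grid triangulations as flag complexes. -/

/-- Two lattice points are equal or joined by an edge of the grid triangulation given by `C`. -/
def Compatible (C : ℤ × ℤ → Prop) (a b : ℤ × ℤ) : Prop :=
  (|a.1 - b.1| ≤ 1 ∧ |a.2 - b.2| ≤ 1) ∧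
    (b = (a.1 + 1, a.2 + 1) → C a) ∧ (a = (b.1 + 1, b.2 + 1) → C b) ∧
    -- `(a.1, b.2)` is the lower left corner of the square with descending diagonal `a b`.
    (b = (a.1 + 1, a.2 - 1) → ¬C (a.1, b.2)) ∧ (a = (b.1 + 1, b.2 - 1) → ¬C (b.1, a.2))

/-- The faces of the grid triangulation of the lattice points `V` given by `C`. -/
def gridFaces (V : Set (ℤ × ℤ)) (C : ℤ × ℤ → Prop) : Set (Finset (ℝ × ℝ)) :=
  {s | (∀ x ∈ s, ∃ a ∈ V, x = toPlane a) ∧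
    ∀ a b, toPlane a ∈ s → toPlane b ∈ s → Compatible C a b}

variable {V : Set (ℤ × ℤ)} {C : ℤ × ℤ → Prop}

theorem gridFaces_mono {s t : Finset (ℝ × ℝ)} (hs : s ∈ gridFaces V C) (hts : t ⊆ s) :
    t ∈ gridFaces V C :=
  ⟨fun x hx => hs.1 x (hts hx), fun a b ha hb => hs.2 a b (hts ha) (hts hb)⟩

theorem exists_box {s : Finset (ℝ × ℝ)} (hs : s ∈ gridFaces V C) (hne : s.Nonempty) :
    ∃ o : ℤ × ℤ, ∀ a, toPlane a ∈ s →
      (a.1 = o.1 ∨ a.1 = o.1 + 1) ∧ (a.2 = o.2 ∨ a.2 = o.2 + 1) := by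
  obtain ⟨x, hx, hxm⟩ := s.exists_min_image (fun x => x.1) hne
  obtain ⟨y, hy, hym⟩ := s.exists_min_image (fun x => x.2) hne
  obtain ⟨a, -, rfl⟩ := hs.1 x hx
  obtain ⟨b, -, rfl⟩ := hs.1 y hy
  refine ⟨(a.1, b.2), fun c hc => ?_⟩
  have h1 : a.1 ≤ c.1 := by simpa [toPlane] using hxm _ hc
  have h2 : b.2 ≤ c.2 := by simpa [toPlane] using hym _ hc
  have h3 := abs_le.1 (hs.2 a c hx hc).1.1
  have h4 := abs_le.1 (hs.2 b c hy hc).1.2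
  simp only
  omega

-- The face lies in a unit square, so `hat_eq_weight` identifies its weights. The left side does not
-- involve `s`: barycentric coordinates depend on `x` only.
open Classical in
theorem hat_eq_of_mem {s : Finset (ℝ × ℝ)} (hs : s ∈ gridFaces V C) {w : ℝ × ℝ → ℝ} {x : ℝ × ℝ}
    (hw : ∀ y ∈ s, 0 ≤ w y) (hsum : ∑ y ∈ s, w y = 1) (hx : ∑ y ∈ s, w y • y = x) (v : ℤ × ℤ) :
    hat C v x = if toPlane v ∈ s then w (toPlane v) else 0 := by
  have hne : s.Nonempty := by
    rw [Finset.nonempty_iff_ne_empty]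
    rintro rfl
    simp at hsum
  obtain ⟨o, ho⟩ := exists_box hs hne
  set W : ℤ × ℤ → ℝ := fun v => if toPlane v ∈ s then w (toPlane v) else 0 with hW
  have W0 : ∀ v, 0 ≤ W v := by
    intro v
    simp only [hW]
    split_ifs with h
    · exact hw _ h
    · exact le_rfl
  have expand : ∀ g : ℝ × ℝ → ℝ, ∑ y ∈ s, w y * g y = W o * g (toPlane o) +
      W (o.1 + 1, o.2) * g (toPlane (o.1 + 1, o.2)) + W (o.1, o.2 + 1) * g (toPlane (o.1, o.2 + 1)) +
      W (o.1 + 1, o.2 + 1) * g (toPlane (o.1 + 1, o.2 + 1)) := by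
    intro g
    set B : Finset (ℤ × ℤ) := {o, (o.1 + 1, o.2), (o.1, o.2 + 1), (o.1 + 1, o.2 + 1)} with hB
    have hsB : s = (B.filter fun v => toPlane v ∈ s).image toPlane := by
      ext y
      simp only [Finset.mem_image, Finset.mem_filter]
      constructor
      · intro hy
        obtain ⟨a, -, rfl⟩ := hs.1 y hy
        refine ⟨a, ⟨?_, hy⟩, rfl⟩
        obtain ⟨h1, h2⟩ := ho a hy
        obtain ⟨a1, a2⟩ := a
        obtain ⟨o1, o2⟩ := o
        simp only [hB, Finset.mem_insert, Finset.mem_singleton, Prod.mk.injEq] at *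
        omega
      · rintro ⟨a, ⟨-, ha⟩, rfl⟩
        exact ha
    have : ∑ y ∈ s, w y * g y = ∑ v ∈ B, W v * g (toPlane v) := by
      conv_lhs => rw [hsB]
      rw [Finset.sum_image toPlane_injective.injOn, Finset.sum_filter]
      refine Finset.sum_congr rfl fun v _ => ?_
      simp only [hW]
      split_ifs <;> simp
    rw [this, hB]
    obtain ⟨o1, o2⟩ := o
    rw [Finset.sum_insert (by simp), Finset.sum_insert (by simp), Finset.sum_insert (by simp),
      Finset.sum_singleton]
    ring
  have hsum' : W o + W (o.1 + 1, o.2) + W (o.1, o.2 + 1) + W (o.1 + 1, o.2 + 1) = 1 := by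
    have := expand fun _ => 1
    simp only [mul_one] at this
    rw [← this, hsum]
  have hx1 : x.1 = o.1 + (W (o.1 + 1, o.2) + W (o.1 + 1, o.2 + 1)) := by
    have h := expand Prod.fst
    have : x.1 = ∑ y ∈ s, w y * y.1 := by rw [← hx, Prod.fst_sum]; rfl
    rw [this, h]
    simp only [toPlane]
    push_cast
    linear_combination (o.1 : ℝ) * hsum'
  have hx2 : x.2 = o.2 + (W (o.1, o.2 + 1) + W (o.1 + 1, o.2 + 1)) := by
    have h := expand Prod.snd
    have : x.2 = ∑ y ∈ s, w y * y.2 := by rw [← hx, Prod.snd_sum]; rfl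
    rw [this, h]
    simp only [toPlane]
    push_cast
    linear_combination (o.2 : ℝ) * hsum'
  have zero : ∀ v, toPlane v ∉ s → W v = 0 := fun v hv => if_neg hv
  have hbox := hat_eq_weight C o (W0 o) (W0 (o.1 + 1, o.2)) (W0 (o.1, o.2 + 1))
    (W0 (o.1 + 1, o.2 + 1)) hsum' hx1 hx2 (by
      intro hC
      by_contra! hcon
      have h1 : toPlane (o.1 + 1, o.2) ∈ s := by
        by_contra h; exact hcon.1 (zero _ h)
      have h2 : toPlane (o.1, o.2 + 1) ∈ s := by
        by_contra h; exact hcon.2 (zero _ h)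
      exact (hs.2 _ _ h2 h1).2.2.2.1 (by simp) hC) (by
      intro hC
      by_contra! hcon
      have h1 : toPlane o ∈ s := by
        by_contra h; exact hcon.1 (zero _ h)
      have h2 : toPlane (o.1 + 1, o.2 + 1) ∈ s := by
        by_contra h; exact hcon.2 (zero _ h)
      exact hC ((hs.2 _ _ h1 h2).2.1 rfl))
  change hat C v x = W v
  by_cases hv : (v.1 = o.1 ∨ v.1 = o.1 + 1) ∧ (v.2 = o.2 ∨ v.2 = o.2 + 1)
  · obtain ⟨v1, v2⟩ := v
    obtain ⟨o1, o2⟩ := o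
    simp only at hv
    rcases hv with ⟨rfl | rfl, rfl | rfl⟩
    · exact hbox.1
    · exact hbox.2.2.1
    · exact hbox.2.1
    · exact hbox.2.2.2
  · rw [zero v fun h => hv (ho v h)]
    have := W0 o
    have := W0 (o.1 + 1, o.2)
    have := W0 (o.1, o.2 + 1)
    have := W0 (o.1 + 1, o.2 + 1)
    exact hat_eq_zero C (o := o) (by linarith) (by linarith) (by linarith) (by linarith) hv

/-- A vertex of `s` outside `t` has weight zero at a common point, since its hat function, computed
in `t`, vanishes there. -/
theorem gridFaces_inter {s t : Finset (ℝ × ℝ)} (hs : s ∈ gridFaces V C) (ht : t ∈ gridFaces V C) :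
    convexHull ℝ (s : Set (ℝ × ℝ)) ∩ convexHull ℝ t ⊆ convexHull ℝ (s ∩ t : Set (ℝ × ℝ)) := by
  classical
  rintro x ⟨hxs, hxt⟩
  obtain ⟨w, hw, hsum, hx⟩ := Finset.mem_convexHull'.1 hxs
  obtain ⟨w', hw', hsum', hx'⟩ := Finset.mem_convexHull'.1 hxt
  have hzero : ∀ y ∈ s, y ∉ s ∩ t → w y = 0 := by
    intro y hy hyt
    obtain ⟨v, -, rfl⟩ := hs.1 y hy
    have h1 := hat_eq_of_mem hs hw hsum hx v
    have h2 := hat_eq_of_mem ht hw' hsum' hx' v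
    rw [if_pos hy] at h1
    rw [if_neg fun h => hyt (Finset.mem_inter.2 ⟨hy, h⟩)] at h2
    rw [← h1, h2]
  rw [← Finset.coe_inter, Finset.mem_convexHull']
  refine ⟨w, fun y hy => hw y (Finset.mem_inter.1 hy).1, ?_, ?_⟩
  · rw [← hsum]
    exact Finset.sum_subset Finset.inter_subset_left fun y hy hyt => hzero y hy hyt
  · rw [← hx]
    exact Finset.sum_subset Finset.inter_subset_left fun y hy hyt => by
      rw [hzero y hy hyt, zero_smul]

/-- A Radon partition of a dependent face would give two disjoint subfaces with intersecting hulls,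
against `gridFaces_inter`. -/
theorem gridFaces_indep {s : Finset (ℝ × ℝ)} (hs : s ∈ gridFaces V C) :
    AffineIndependent ℝ ((↑) : s → ℝ × ℝ) := by
  classical
  by_contra h
  obtain ⟨I, x, hx₁, hx₂⟩ := Convex.radon_partition h
  have himg : ∀ J : Set s, ∃ t : Finset (ℝ × ℝ), t ⊆ s ∧ (t : Set (ℝ × ℝ)) = (↑) '' J := by
    intro J
    refine ⟨s.filter fun y => y ∈ ((↑) '' J : Set (ℝ × ℝ)), Finset.filter_subset _ _, ?_⟩
    ext y
    simp only [Finset.coe_filter, Set.mem_ofPred_eq]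
    exact ⟨fun h => h.2, fun h => ⟨by obtain ⟨z, -, rfl⟩ := h; exact z.2, h⟩⟩
  obtain ⟨t₁, ht₁, e₁⟩ := himg I
  obtain ⟨t₂, ht₂, e₂⟩ := himg Iᶜ
  rw [← e₁] at hx₁
  rw [← e₂] at hx₂
  have := gridFaces_inter (gridFaces_mono hs ht₁) (gridFaces_mono hs ht₂) ⟨hx₁, hx₂⟩
  rw [e₁, e₂, ← Set.image_inter Subtype.val_injective, Set.inter_compl_self, Set.image_empty,
    convexHull_empty] at this
  exact this

/-- The grid triangulation of the lattice points `V` given by `C`. -/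
def gridComplex (V : Set (ℤ × ℤ)) (C : ℤ × ℤ → Prop) : SimplicialComplex ℝ (ℝ × ℝ) :=
  SimplicialComplex.ofErase (gridFaces V C) (fun _ hs => gridFaces_indep hs)
    (fun _ _ hts hs => gridFaces_mono hs hts) fun _ hs _ ht => gridFaces_inter hs ht

theorem mem_gridComplex {s : Finset (ℝ × ℝ)} :
    s ∈ (gridComplex V C).faces ↔ s ∈ gridFaces V C ∧ s.Nonempty := by
  rw [Finset.nonempty_iff_ne_empty]
  exact Iff.rfl

theorem idet_of_near {a b c : ℤ × ℤ} (hab : |a.1 - b.1| ≤ 1 ∧ |a.2 - b.2| ≤ 1)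
    (hac : |a.1 - c.1| ≤ 1 ∧ |a.2 - c.2| ≤ 1) (hbc : |b.1 - c.1| ≤ 1 ∧ |b.2 - c.2| ≤ 1)
    (h₁ : a ≠ b) (h₂ : a ≠ c) (h₃ : b ≠ c) : |idet a b c| = 1 := by
  obtain ⟨a1, a2⟩ := a
  obtain ⟨b1, b2⟩ := b
  obtain ⟨c1, c2⟩ := c
  simp only [abs_le, ne_eq, Prod.mk.injEq, idet] at *
  obtain ⟨u1, rfl⟩ : ∃ u, b1 = a1 + u := ⟨b1 - a1, by ring⟩
  obtain ⟨u2, rfl⟩ : ∃ u, b2 = a2 + u := ⟨b2 - a2, by ring⟩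
  obtain ⟨v1, rfl⟩ : ∃ u, c1 = a1 + u := ⟨c1 - a1, by ring⟩
  obtain ⟨v2, rfl⟩ : ∃ u, c2 = a2 + u := ⟨c2 - a2, by ring⟩
  simp only [add_sub_cancel_left]
  have i1 : -1 ≤ u1 := by omega
  have i2 : u1 ≤ 1 := by omega
  have i3 : -1 ≤ u2 := by omega
  have i4 : u2 ≤ 1 := by omega
  have i5 : -1 ≤ v1 := by omega
  have i6 : v1 ≤ 1 := by omega
  have i7 : -1 ≤ v2 := by omega
  have i8 : v2 ≤ 1 := by omega
  interval_cases u1 <;> interval_cases u2 <;> interval_cases v1 <;> interval_cases v2 <;>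
    first | omega | norm_num

theorem Compatible.symm {C : ℤ × ℤ → Prop} {a b : ℤ × ℤ} (h : Compatible C a b) :
    Compatible C b a := by
  obtain ⟨⟨h1, h2⟩, h3, h4, h5, h6⟩ := h
  exact ⟨⟨by rwa [abs_sub_comm], by rwa [abs_sub_comm]⟩, h4, h3, h6, h5⟩

theorem Compatible.refl (C : ℤ × ℤ → Prop) (a : ℤ × ℤ) : Compatible C a a := by
  refine ⟨by simp, ?_, ?_, ?_, ?_⟩ <;> (intro h; simp [Prod.ext_iff] at h)

theorem Compatible.swap {C : ℤ × ℤ → Prop} (hC : ∀ o, C o.swap ↔ C o) {a b : ℤ × ℤ}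
    (h : Compatible C a b) : Compatible C a.swap b.swap := by
  obtain ⟨⟨h1, h2⟩, h3, h4, h5, h6⟩ := h
  obtain ⟨a1, a2⟩ := a
  obtain ⟨b1, b2⟩ := b
  refine ⟨⟨h2, h1⟩, ?_, ?_, ?_, ?_⟩ <;> simp only [Prod.swap_prod_mk, Prod.mk.injEq] at *
  · rintro ⟨e1, e2⟩
    exact (hC (a1, a2)).2 (h3 ⟨e2, e1⟩)
  · rintro ⟨e1, e2⟩
    exact (hC (b1, b2)).2 (h4 ⟨e2, e1⟩)
  · rintro ⟨e1, e2⟩ hc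
    exact h6 ⟨by omega, by omega⟩ ((hC _).1 hc)
  · rintro ⟨e1, e2⟩ hc
    exact h5 ⟨by omega, by omega⟩ ((hC _).1 hc)

theorem pair_mem_gridComplex {a b : ℤ × ℤ} (ha : a ∈ V) (hb : b ∈ V) :
    {toPlane a, toPlane b} ∈ (gridComplex V C).faces ↔ Compatible C a b := by
  rw [mem_gridComplex]
  constructor
  · rintro ⟨⟨-, h⟩, -⟩
    exact h a b (by simp) (by simp)
  · refine fun h => ⟨⟨?_, ?_⟩, Finset.insert_nonempty _ _⟩
    · intro x hx
      simp only [Finset.mem_insert, Finset.mem_singleton] at hx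
      rcases hx with rfl | rfl
      · exact ⟨a, ha, rfl⟩
      · exact ⟨b, hb, rfl⟩
    · intro x y hx hy
      simp only [Finset.mem_insert, Finset.mem_singleton, toPlane_injective.eq_iff] at hx hy
      rcases hx with rfl | rfl <;> rcases hy with rfl | rfl
      exacts [.refl _ _, h, h.symm, .refl _ _]

theorem combo_mem_gridComplex_space {a b c : ℤ × ℤ} (ha : a ∈ V) (hb : b ∈ V) (hc : c ∈ V)
    (hab : Compatible C a b) (hac : Compatible C a c) (hbc : Compatible C b c) {α β γ : ℝ}
    (hα : 0 ≤ α) (hβ : 0 ≤ β) (hγ : 0 ≤ γ) (h : α + β + γ = 1) {x : ℝ × ℝ}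
    (h1 : x.1 = α * a.1 + β * b.1 + γ * c.1) (h2 : x.2 = α * a.2 + β * b.2 + γ * c.2) :
    x ∈ (gridComplex V C).space := by
  refine SimplicialComplex.mem_space_iff.2 ⟨{toPlane a, toPlane b, toPlane c},
    mem_gridComplex.2 ⟨⟨?_, ?_⟩, Finset.insert_nonempty _ _⟩, ?_⟩
  · intro x hx
    simp only [Finset.mem_insert, Finset.mem_singleton] at hx
    rcases hx with rfl | rfl | rfl
    exacts [⟨a, ha, rfl⟩, ⟨b, hb, rfl⟩, ⟨c, hc, rfl⟩]
  · intro x y hx hy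
    simp only [Finset.mem_insert, Finset.mem_singleton, toPlane_injective.eq_iff] at hx hy
    rcases hx with rfl | rfl | rfl <;> rcases hy with rfl | rfl | rfl
    exacts [.refl _ _, hab, hac, hab.symm, .refl _ _, hbc, hac.symm, hbc.symm, .refl _ _]
  · rw [Finset.coe_insert, Finset.coe_pair]
    convert combo_mem_convexHull_triple (a := toPlane a) (b := toPlane b) (c := toPlane c)
      hα hβ hγ h using 1
    ext
    · simpa [toPlane] using h1
    · simpa [toPlane] using h2

/-! ### Symmetric grid triangulations and the lower bound. -/

theorem convexHull_latticePoints_dilatedTriangle (d : ℕ) :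
    convexHull ℝ (latticePoints (dilatedTriangle d)) = dilatedTriangle d := by
  refine Set.Subset.antisymm (convexHull_min (fun x hx => hx.1) (convex_convexHull _ _))
    (convexHull_mono fun x hx => ⟨subset_convexHull _ _ hx, ?_⟩)
  simp only [Set.mem_insert_iff, Set.mem_singleton_iff] at hx
  rcases hx with rfl | rfl | rfl
  · exact ⟨0, 0, by simp⟩
  · exact ⟨d, 0, by simp⟩
  · exact ⟨0, d, by simp⟩

/-- Ascending diagonals are allowed only in squares inside the triangle. A square cut by the
hypotenuse has its descending diagonal on it, and its lower half suffices. -/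
theorem dilatedTriangle_subset_space {d : ℕ} (hd : 1 ≤ d)
    (hC : ∀ o, C o → 0 ≤ o.1 ∧ 0 ≤ o.2 ∧ o.1 + o.2 + 2 ≤ d) :
    dilatedTriangle d ⊆ (gridComplex (intPoints (dilatedTriangle d)) C).space := by
  intro x hx
  obtain ⟨hx1, hx2, hx3⟩ := (mem_dilatedTriangle hd).1 hx
  obtain ⟨m, hm⟩ : ∃ m, m = ⌊x.1⌋ := ⟨_, rfl⟩
  obtain ⟨n, hn⟩ : ∃ n, n = ⌊x.2⌋ := ⟨_, rfl⟩
  have m1 : (m : ℝ) ≤ x.1 := hm ▸ Int.floor_le _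
  have m2 : x.1 < m + 1 := hm ▸ Int.lt_floor_add_one _
  have n1 : (n : ℝ) ≤ x.2 := hn ▸ Int.floor_le _
  have n2 : x.2 < n + 1 := hn ▸ Int.lt_floor_add_one _
  have m0 : 0 ≤ m := hm ▸ Int.floor_nonneg.2 hx1
  have n0 : 0 ≤ n := hn ▸ Int.floor_nonneg.2 hx2
  have hmn : m + n ≤ d := by
    have : ((m + n : ℤ) : ℝ) ≤ d := by push_cast; linarith
    exact_mod_cast this
  have mem : ∀ a b : ℤ, 0 ≤ a → 0 ≤ b → a + b ≤ d → (a, b) ∈ intPoints (dilatedTriangle d) :=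
    fun a b ha hb hab => (mem_intPoints_dilatedTriangle hd).2 ⟨ha, hb, hab⟩
  have e1 : Compatible C (m, n) (m + 1, n) := by
    refine ⟨by simp, ?_, ?_, ?_, ?_⟩ <;> (intro h; simp [Prod.ext_iff] at h) <;> omega
  have e2 : Compatible C (m, n) (m, n + 1) := by
    refine ⟨by simp, ?_, ?_, ?_, ?_⟩ <;> (intro h; simp [Prod.ext_iff] at h)
  have e3 : Compatible C (m + 1, n) (m + 1, n + 1) := by
    refine ⟨by simp, ?_, ?_, ?_, ?_⟩ <;> (intro h; simp [Prod.ext_iff] at h)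
  have e4 : Compatible C (m, n + 1) (m + 1, n + 1) := by
    refine ⟨by simp, ?_, ?_, ?_, ?_⟩ <;> (intro h; simp [Prod.ext_iff] at h)
  by_cases hc : C (m, n)
  · have hle := (hC _ hc).2.2
    simp only at hle
    have e5 : Compatible C (m, n) (m + 1, n + 1) := by
      refine ⟨by simp, fun _ => hc, ?_, ?_, ?_⟩ <;> (intro h; simp [Prod.ext_iff] at h) <;> omega
    rcases le_total (x.2 - n) (x.1 - m) with hle' | hle'
    · refine combo_mem_gridComplex_space (mem m n m0 n0 hmn)
        (mem (m + 1) n (by omega) n0 (by omega))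
        (mem (m + 1) (n + 1) (by omega) (by omega) (by omega))
        e1 e5 e3 (α := 1 - (x.1 - m)) (β := (x.1 - m) - (x.2 - n)) (γ := x.2 - n)
        (by linarith) (by linarith) (by linarith) (by ring) ?_ ?_ <;> push_cast <;> ring
    · refine combo_mem_gridComplex_space (mem m n m0 n0 hmn)
        (mem m (n + 1) m0 (by omega) (by omega))
        (mem (m + 1) (n + 1) (by omega) (by omega) (by omega))
        e2 e5 e4 (α := 1 - (x.2 - n)) (β := (x.2 - n) - (x.1 - m)) (γ := x.1 - m)
        (by linarith) (by linarith) (by linarith) (by ring) ?_ ?_ <;> push_cast <;> ring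
  · have e6 : Compatible C (m + 1, n) (m, n + 1) := by
      refine ⟨by simp, ?_, ?_, ?_, ?_⟩
      · intro h; simp [Prod.ext_iff] at h; omega
      · intro h; simp [Prod.ext_iff] at h; omega
      · intro h; simp [Prod.ext_iff] at h; omega
      · intro _; exact hc
    rcases hmn.eq_or_lt with heq | hlt
    -- On `m + n = d` the only point of the triangle in this square is the corner itself.
    · have hs : (m : ℝ) + n = d := by exact_mod_cast heq
      exact combo_mem_gridComplex_space (mem m n m0 n0 hmn) (mem m n m0 n0 hmn) (mem m n m0 n0 hmn)
        (.refl _ _) (.refl _ _) (.refl _ _) (α := 1) (β := 0) (γ := 0) zero_le_one le_rfl le_rfl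
        (by ring) (by simp only; linarith) (by simp only; linarith)
    rcases le_or_gt ((x.1 - m) + (x.2 - n)) 1 with hle' | hlt'
    · refine combo_mem_gridComplex_space (mem m n m0 n0 hmn)
        (mem (m + 1) n (by omega) n0 (by omega)) (mem m (n + 1) m0 (by omega) (by omega))
        e1 e2 e6 (α := 1 - (x.1 - m) - (x.2 - n)) (β := x.1 - m) (γ := x.2 - n)
        (by linarith) (by linarith) (by linarith) (by ring) ?_ ?_ <;> push_cast <;> ring
    · have hs : m + n + 1 < d := by
        have : ((m + n + 1 : ℤ) : ℝ) < d := by push_cast; linarith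
        exact_mod_cast this
      refine combo_mem_gridComplex_space (mem (m + 1) n (by omega) n0 (by omega))
        (mem m (n + 1) m0 (by omega) (by omega))
        (mem (m + 1) (n + 1) (by omega) (by omega) (by omega))
        e6 e3 e4 (α := 1 - (x.2 - n)) (β := 1 - (x.1 - m)) (γ := (x.1 - m) + (x.2 - n) - 1)
        (by linarith) (by linarith) (by linarith) (by ring) ?_ ?_ <;> push_cast <;> ring

theorem isUnimodularTriangulation_gridComplex {d : ℕ} (hd : 1 ≤ d)
    (hC : ∀ o, C o → 0 ≤ o.1 ∧ 0 ≤ o.2 ∧ o.1 + o.2 + 2 ≤ d) :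
    IsUnimodularTriangulation (dilatedTriangle d)
      (gridComplex (intPoints (dilatedTriangle d)) C) where
  vertices_subset x hx := by
    obtain ⟨a, ha, rfl⟩ := (mem_gridComplex.1 hx).1.1 x (Finset.mem_singleton_self x)
    exact mem_latticePoints.2 ⟨a, ha, rfl⟩
  space_eq := by
    rw [convexHull_latticePoints_dilatedTriangle]
    refine Set.Subset.antisymm (fun x hx => ?_) (dilatedTriangle_subset_space hd hC)
    obtain ⟨s, hs, hxs⟩ := SimplicialComplex.mem_space_iff.1 hx
    refine convexHull_min (fun y hy => ?_) (convex_convexHull _ _) hxs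
    obtain ⟨a, ha, rfl⟩ := (mem_gridComplex.1 hs).1.1 y hy
    exact ha
  unimodular s hs a ha b hb c hc hab hac hbc := by
    have hs' := (mem_gridComplex.1 hs).1
    obtain ⟨a, -, rfl⟩ := hs'.1 a ha
    obtain ⟨b, -, rfl⟩ := hs'.1 b hb
    obtain ⟨c, -, rfl⟩ := hs'.1 c hc
    rw [det3_toPlane]
    exact_mod_cast idet_of_near (hs'.2 a b ha hb).1 (hs'.2 a c ha hc).1 (hs'.2 b c hb hc).1
      (fun h => hab (by rw [h])) (fun h => hac (by rw [h])) (fun h => hbc (by rw [h]))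

theorem isSymmetric_gridComplex {d : ℕ} (hd : 1 ≤ d) (hC : ∀ o, C o.swap ↔ C o) :
    IsSymmetric (gridComplex (intPoints (dilatedTriangle d)) C) := by
  intro s hs
  obtain ⟨⟨h1, h2⟩, hne⟩ := mem_gridComplex.1 hs
  have hmem : ∀ a, toPlane a ∈ s.map (Equiv.prodComm ℝ ℝ).toEmbedding → toPlane a.swap ∈ s := by
    intro a ha
    obtain ⟨x, hx, h⟩ := Finset.mem_map.1 ha
    have : x = toPlane a.swap := by
      rw [← Prod.swap_swap x]
      exact congrArg Prod.swap h
    rwa [← this]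
  refine mem_gridComplex.2 ⟨⟨?_, ?_⟩, by simpa using hne⟩
  · intro x hx
    obtain ⟨y, hy, rfl⟩ := Finset.mem_map.1 hx
    obtain ⟨a, ha, rfl⟩ := h1 y hy
    rw [mem_intPoints_dilatedTriangle hd] at ha
    exact ⟨a.swap, (mem_intPoints_dilatedTriangle hd).2
      ⟨ha.2.1, ha.1, by simp only [Prod.fst_swap, Prod.snd_swap]; linarith⟩, rfl⟩
  · intro a b ha hb
    simpa using (h2 _ _ (hmem a ha) (hmem b hb)).swap hC

/-- The squares with ascending diagonal: those in `S`, shifted to the right by `k`, and their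
reflections. -/
def flippedSquares (k : ℕ) (S : Finset (ℕ × ℕ)) (o : ℤ × ℤ) : Prop :=
  ∃ z ∈ S, o = ((k + z.1 : ℤ), (z.2 : ℤ)) ∨ o = ((z.2 : ℤ), (k + z.1 : ℤ))

/-- The shift by `k` puts the block below the axis, disjoint from its reflection, and `3 k ≤ d`
keeps its upper right corner `(2k, k)` in the triangle. The ascending diagonals of the block recover
`S`. -/
theorem two_pow_sq_le_symCount {d k : ℕ} (hk : 1 ≤ k) (hd : 3 * k ≤ d) :
    2 ^ (k ^ 2) ≤ symCount d := by
  have hd1 : 1 ≤ d := by omega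
  set Q : Finset (ℕ × ℕ) := Finset.range k ×ˢ Finset.range k with hQ
  have hrange : ∀ S ⊆ Q, ∀ o, flippedSquares k S o → 0 ≤ o.1 ∧ 0 ≤ o.2 ∧ o.1 + o.2 + 2 ≤ d := by
    rintro S hS o ⟨z, hz, h⟩
    have hz' := hS hz
    simp only [hQ, Finset.mem_product, Finset.mem_range] at hz'
    rcases h with rfl | rfl <;> simp only <;> omega
  have hswap : ∀ S o, flippedSquares k S o.swap ↔ flippedSquares k S o := by
    rintro S ⟨x, y⟩
    simp only [flippedSquares, Prod.swap_prod_mk, Prod.mk.injEq]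
    exact exists_congr fun z => and_congr_right fun _ => by tauto
  have hmem : ∀ S ⊆ Q, ∀ z ∈ Q, z ∈ S ↔
      {toPlane ((k + z.1 : ℤ), (z.2 : ℤ)), toPlane ((k + z.1 + 1 : ℤ), (z.2 + 1 : ℤ))} ∈
        (gridComplex (intPoints (dilatedTriangle d)) (flippedSquares k S)).faces := by
    intro S hS z hz
    have hz' := hz
    simp only [hQ, Finset.mem_product, Finset.mem_range] at hz'
    rw [pair_mem_gridComplex ((mem_intPoints_dilatedTriangle hd1).2 (by simp only; omega))
      ((mem_intPoints_dilatedTriangle hd1).2 (by simp only; omega))]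
    constructor
    · intro hzS
      refine ⟨by simp, fun _ => ⟨z, hzS, Or.inl rfl⟩, ?_, ?_, ?_⟩ <;>
        (intro h; simp [Prod.ext_iff] at h) <;> omega
    · intro h
      obtain ⟨y, hy, h | h⟩ := h.2.1 rfl
      · simp only [Prod.mk.injEq] at h
        have : z = y := by ext <;> omega
        rwa [this]
      · have hy' := hS hy
        simp only [hQ, Finset.mem_product, Finset.mem_range] at hy'
        simp only [Prod.mk.injEq] at h
        omega
  have hcard : (Q.powerset : Set (Finset (ℕ × ℕ))).ncard = 2 ^ (k ^ 2) := by
    rw [Set.ncard_coe_finset, Finset.card_powerset, hQ, Finset.card_product, Finset.card_range, sq]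
  rw [← hcard]
  refine Set.ncard_le_ncard_of_injOn
    (fun S => gridComplex (intPoints (dilatedTriangle d)) (flippedSquares k S)) ?_ ?_
    (finite_dilatedTriangle d)
  · intro S hS
    have hS' := Finset.mem_powerset.1 (Finset.mem_coe.1 hS)
    exact ⟨isUnimodularTriangulation_gridComplex hd1 (hrange S hS'),
      isSymmetric_gridComplex hd1 (hswap S)⟩
  · intro S hS S' hS' heq
    have h1 := Finset.mem_powerset.1 (Finset.mem_coe.1 hS)
    have h2 := Finset.mem_powerset.1 (Finset.mem_coe.1 hS')
    have heq' := congrArg (fun K : SimplicialComplex ℝ (ℝ × ℝ) => K.faces) heq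
    simp only at heq'
    ext z
    constructor
    · intro hz
      have := (hmem S h1 z (h1 hz)).1 hz
      rw [heq'] at this
      exact (hmem S' h2 z (h1 hz)).2 this
    · intro hz
      have := (hmem S' h2 z (h2 hz)).1 hz
      rw [← heq'] at this
      exact (hmem S h1 z (h2 hz)).2 this

theorem rpow_le_symCount {d : ℕ} (hd : 3 ≤ d) :
    (2 : ℝ) ^ (1 / 25 * (d : ℝ) ^ 2) ≤ symCount d := by
  have hk := two_pow_sq_le_symCount (d := d) (k := d / 3) (by omega) (by omega)
  calc (2 : ℝ) ^ (1 / 25 * (d : ℝ) ^ 2) ≤ (2 : ℝ) ^ (((d / 3) ^ 2 : ℕ) : ℝ) := by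
        refine Real.rpow_le_rpow_of_exponent_le one_le_two ?_
        -- Rounding down costs at most a factor `5 / 3` when `d ≥ 3` (worst at `d = 5`), whence the
        -- constant `1 / 25`.
        have h : (d : ℝ) ≤ 5 * ((d / 3 : ℕ) : ℝ) := by exact_mod_cast (by omega : d ≤ 5 * (d / 3))
        push_cast
        nlinarith [Nat.cast_nonneg (α := ℝ) d]
    _ ≤ symCount d := by
        rw [Real.rpow_natCast]
        exact_mod_cast hk

end SymTri

theorem mainTheorem1 :
    (∀ d : ℕ, 1 ≤ d →
      (SymTri.halfCount d : ℝ) ≤ SymTri.U d ∧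
      SymTri.U d ≤ (2 : ℝ) ^ (3 / 4 * (d : ℝ) ^ 2 + (d : ℝ) - 3 / 4) ∧
      (SymTri.symCount d : ℝ) ≤ 2 ^ (d / 2) * SymTri.U d) ∧
    (∃ c : ℝ, 0 < c ∧ ∃ d₀ : ℕ, ∀ d : ℕ, d₀ ≤ d →
      (2 : ℝ) ^ (c * (d : ℝ) ^ 2) ≤ (SymTri.symCount d : ℝ)) ∧
    (∃ C : ℝ, 0 < C ∧ ∃ d₀ : ℕ, ∀ d : ℕ, d₀ ≤ d →
      2 ^ (d / 2) * SymTri.U d ≤ (2 : ℝ) ^ (C * (d : ℝ) ^ 2)) :=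
  ⟨fun _ hd => ⟨SymTri.halfCount_le_U hd, SymTri.U_le hd, SymTri.symCount_le_U hd⟩,
    ⟨1 / 25, by norm_num, 3, fun _ hd => SymTri.rpow_le_symCount hd⟩,
    ⟨3, by norm_num, 1, fun _ hd => SymTri.two_pow_mul_U_le hd⟩⟩
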